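/- Let $f_0\colon\mathbb R^n\to\mathbb R$ and $F\colon\mathbb R^n\to\mathbb R^m$ be twice continuously differentiable, let $g\colon\mathbb R^m\to\mathbb R\cup\{-\infty,\infty\}$ be proper, lower semicontinuous and convex, and put $f(x,u):=f_0(x)+g(F(x)+u)$ and $L(x,y):=f_0(x)+y^\top F(x)$. All spaces carry Euclidean norms. **Notation.** For a set $C$ in a Euclidean space and $x\in C$ let $$T_C(x):=\{d\mid \exists\, d_k\to d,\ t_k\downarrow 0:\ x+t_kd_k\in C\ \forall k\},$$ $$T^{\#}_C(x):=\{d\mid\exists\, x_k\to x,\ d_k\to d:\ x_k\in C,\ d_k\in T_C(x_k)\ \forall k\},$$ let $\widehat N_C(x):=\{\eta\mid \eta^\top(x'-x)\le o(\|x'-x\|)\ \forall x'\in C\}$ be the regular normal cone, and let $$N_C(x):=\{\eta\mid\exists\,x_k\to x,\ \eta_k\to\eta:\ x_k\in C,\ \eta_k\in\widehat N_C(x_k)\ \forall k\}$$ be the limiting normal cone. For an extended-real-valued $h$ that is finite at $x$, let $\partial h(x):=\{z\mid(z,-1)\in N_{\operatorname{epi}h}(x,h(x))\}$ and $\partial^\infty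 h(x):=\{z\mid(z,0)\in N_{\operatorname{epi}h}(x,h(x))\}$; where $h$ is not finite, both sets are empty. For a set-valued mapping $\Upsilon$, let $\operatorname{gph}\Upsilon:=\{(x,y)\mid y\in\Upsilon(x)\}$, let $\operatorname{dom}\Upsilon:=\{x\mid\Upsilon(x)\neq\emptyset\}$, and let the limiting graphical derivative $D^{\#}\Upsilon(x,y)$ be the set-valued mapping with graph $T^{\#}_{\operatorname{gph}\Upsilon}(x,y)$. * $\Upsilon$ is *isolatedly calm at* $(x,y)\in\operatorname{gph}\Upsilon$ *with constant* $\kappa$ if there is a neighborhood $V$ of $y$ such that $\|y'-y\|\le\kappa\|x'-x\|$ for all $x'$ and all $y'\in\Upsilon(x')\cap V$. It is *isolatedly calm around* $(x,y)\in\operatorname{gph}\Upsilon$ if there are $\kappa>0$ and a neighborhood $W$ of $(x,y)$ such that it is isolatedly calm with constant $\kappa$ at all points of $W\cap\operatorname{gph}\Upsilon$. * $\Upsilon$ is *inner calm\* in the fuzzy sense* w.r.t. $\operatorname{dom}\Upsilon$ at $x$ in direction $d$ if $d\notin T_{\operatorname{dom}\Upsilon}(x)$, or if there is $\kappa_d>0$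 for which there exist $y$ and sequences $d_k\to d$, $t_k\downarrow0$, $y_k\to y$ with $y_k\in\Upsilon(x+t_kd_k)$ and $\|y_k-y\|\le\kappa_dt_k\|d_k\|$ for all $k$. Its modulus is $0$ if $d\notin T_{\operatorname{dom}\Upsilon}(x)$, and the infimum of all such $\kappa_d$ otherwise. * $\Upsilon$ is *locally uniformly inner calm\* in the fuzzy sense* w.r.t. $\operatorname{dom}\Upsilon$ at $x$ in direction $d$ if there are neighborhoods $U$ of $x$ and $N$ of $d$ and a constant $\kappa>0$ such that, at each $x'\in U\cap\operatorname{dom}\Upsilon$ and in each direction $d'\in N$, $\Upsilon$ is inner calm\* in the fuzzy sense w.r.t. $\operatorname{dom}\Upsilon$ with modulus at most $\kappa$. Define $M(v,u):=\{x\mid v\in\partial_xf(x,u)\}$, where $\partial_xf(x,u)$ is the limiting subdifferential of $f(\cdot,u)$ at $x$, and $Y(v,u,x):=\{y\mid(v,y)\in\partial f(x,u)\}$. Let $\bar x$ satisfy $0\in\partial_xf(\bar x,0)$. A multiplier $\bar y\in Y(0,0,\bar x)$ is called *strongly noncritical* for $\bar x$ if, for all $(d^x,d^y)\in\mathbb R^n\times\mathbb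 R^m$, $$\nabla^2_{xx}L(\bar x,\bar y)d^x+F'(\bar x)^\top d^y=0,\quad d^y\in D^{\#}(\partial g)(F(\bar x),\bar y)(F'(\bar x)d^x)\quad\Longrightarrow\quad d^x=0.$$ **Corollary.** Consider the following statements. 1. $M$ is isolatedly calm around $((0,0),\bar x)$. 2. Each $\bar y\in Y(0,0,\bar x)$ is strongly noncritical for $\bar x$, and $Y$ is locally uniformly inner calm\* in the fuzzy sense w.r.t. $\operatorname{dom}Y$ at $(0,0,\bar x)$ in each direction $(0,0,d^x)$ with $d^x\neq0$. Then (1) always implies (2). If the basic qualification condition $$F'(\bar x)^\top y=0,\ y\in\partial^\infty g(F(\bar x))\quad\Longrightarrow\quad y=0$$ holds, then (2) implies (1). -/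

import Mathlib

open Filter Topology

noncomputable section

namespace CritMult

/-- The Euclidean space `ℝⁿ`. -/
abbrev R (n : ℕ) := EuclideanSpace ℝ (Fin n)

/-- The product `X × Y` with the Euclidean product norm (and inner product). -/
abbrev L2Prod (X Y : Type*) := WithLp 2 (X × Y)

/-- The pair `(x, y)` as a point of the Euclidean product. -/
abbrev pair {X Y : Type*} (x : X) (y : Y) : L2Prod X Y := WithLp.toLp 2 (x, y)

section Cones

/-- The (Bouligand) tangent cone to `C` at `x`. -/
def tangentCone {E : Type*} [NormedAddCommGroup E] [NormedSpace ℝ E] (C : Set E) (x : E) :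
    Set E :=
  {d | ∃ (dk : ℕ → E) (tk : ℕ → ℝ), Tendsto dk atTop (𝓝 d) ∧
    (∀ k, 0 < tk k) ∧ Tendsto tk atTop (𝓝 0) ∧ ∀ k, x + tk k • dk k ∈ C}

/-- The limiting tangent cone to `C` at `x`. -/
def limitingTangentCone {E : Type*} [NormedAddCommGroup E] [NormedSpace ℝ E] (C : Set E) (x : E) :
    Set E :=
  {d | ∃ (xk dk : ℕ → E), Tendsto xk atTop (𝓝 x) ∧ Tendsto dk atTop (𝓝 d) ∧
    ∀ k, xk k ∈ C ∧ dk k ∈ tangentCone C (xk k)}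

/-- The regular (Fréchet) normal cone to `C` at `x`:
`⟪η, x' - x⟫ ≤ o(‖x' - x‖)` for `x' ∈ C`. -/
def regularNormalCone {E : Type*} [NormedAddCommGroup E] [InnerProductSpace ℝ E] (C : Set E)
    (x : E) : Set E :=
  {η | ∀ ε : ℝ, 0 < ε → ∀ᶠ x' in 𝓝[C] x, inner ℝ η (x' - x) ≤ ε * ‖x' - x‖}

/-- The limiting (Mordukhovich) normal cone to `C` at `x`. -/
def limitingNormalCone {E : Type*} [NormedAddCommGroup E] [InnerProductSpace ℝ E] (C : Set E)
    (x : E) : Set E :=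
  {η | ∃ (xk ηk : ℕ → E), Tendsto xk atTop (𝓝 x) ∧ Tendsto ηk atTop (𝓝 η) ∧
    ∀ k, xk k ∈ C ∧ ηk k ∈ regularNormalCone C (xk k)}

end Cones

section Functions

variable {E : Type*} [NormedAddCommGroup E] [InnerProductSpace ℝ E]

/-- The epigraph of an extended-real-valued function. -/
def epi (h : E → EReal) : Set (L2Prod E ℝ) :=
  {p | h p.fst ≤ (p.snd : EReal)}

/-- `h` is proper: it never takes the value `-∞` and is not identically `∞`. -/
def IsProper (h : E → EReal) : Prop :=
  (∃ x, h x < ⊤) ∧ ∀ x, ⊥ < h x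

/-- Convexity of an extended-real-valued function: its epigraph is a convex set. -/
def IsConvex (h : E → EReal) : Prop :=
  Convex ℝ (epi h)

/-- The limiting subdifferential `∂h(x)`; it is empty where `h` is not finite. -/
def subdiff (h : E → EReal) (x : E) : Set E :=
  {z | h x ≠ ⊤ ∧ h x ≠ ⊥ ∧
    pair z (-1 : ℝ) ∈ limitingNormalCone (epi h) (pair x (h x).toReal)}

/-- The singular subdifferential `∂^∞ h(x)`; it is empty where `h` is not finite. -/
def singularSubdiff (h : E → EReal) (x : E) : Set E :=
  {z | h x ≠ ⊤ ∧ h x ≠ ⊥ ∧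
    pair z (0 : ℝ) ∈ limitingNormalCone (epi h) (pair x (h x).toReal)}

end Functions

section SetValued

variable {X Y : Type*} [NormedAddCommGroup X] [NormedSpace ℝ X]
  [NormedAddCommGroup Y] [NormedSpace ℝ Y]

/-- The graph of a set-valued mapping. -/
def gph {X Y : Type*} (Υ : X → Set Y) : Set (X × Y) :=
  {p | p.2 ∈ Υ p.1}

/-- The domain of a set-valued mapping. -/
def dom {X Y : Type*} (Υ : X → Set Y) : Set X :=
  {x | (Υ x).Nonempty}

/-- The limiting graphical derivative `D^#Υ(x, y)`. -/
def limitingGraphicalDeriv (Υ : X → Set Y) (x : X) (y : Y) : X → Set Y :=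
  fun d => {e | (d, e) ∈ limitingTangentCone (gph Υ) (x, y)}

/-- `Υ` is isolatedly calm at `(x, y)` with constant `κ`. -/
def IsolatedlyCalmAt (Υ : X → Set Y) (x : X) (y : Y) (κ : ℝ) : Prop :=
  ∃ V ∈ 𝓝 y, ∀ x', ∀ y' ∈ Υ x' ∩ V, ‖y' - y‖ ≤ κ * ‖x' - x‖

/-- `Υ` is isolatedly calm around `(x, y)`. -/
def IsolatedlyCalmAround (Υ : X → Set Y) (x : X) (y : Y) : Prop :=
  ∃ κ : ℝ, 0 < κ ∧ ∃ W ∈ 𝓝 (x, y), ∀ p ∈ W ∩ gph Υ, IsolatedlyCalmAt Υ p.1 p.2 κ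

/-- `κ` is a constant with which `Υ` satisfies the sequential condition in the definition of
inner calmness* in the fuzzy sense at `x` in direction `d`. -/
def FuzzyInnerCalmConst (Υ : X → Set Y) (x d : X) (κ : ℝ) : Prop :=
  0 < κ ∧ ∃ (y : Y) (dk : ℕ → X) (tk : ℕ → ℝ) (yk : ℕ → Y),
    Tendsto dk atTop (𝓝 d) ∧ (∀ k, 0 < tk k) ∧ Tendsto tk atTop (𝓝 0) ∧
    Tendsto yk atTop (𝓝 y) ∧
    ∀ k, x + tk k • dk k ∈ dom Υ ∧ yk k ∈ Υ (x + tk k • dk k) ∧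
      ‖yk k - y‖ ≤ κ * tk k * ‖dk k‖

/-- `Υ` is inner calm* in the fuzzy sense w.r.t. its domain at `x` in direction `d`. -/
def FuzzyInnerCalm (Υ : X → Set Y) (x d : X) : Prop :=
  d ∉ tangentCone (dom Υ) x ∨ ∃ κ, FuzzyInnerCalmConst Υ x d κ

open Classical in
/-- The modulus of inner calmness* in the fuzzy sense w.r.t. the domain at `x` in direction `d`
(meaningful only if `FuzzyInnerCalm Υ x d` holds). -/
def fuzzyInnerCalmModulus (Υ : X → Set Y) (x d : X) : ℝ :=
  if d ∈ tangentCone (dom Υ) x then sInf {κ | FuzzyInnerCalmConst Υ x d κ} else 0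

/-- `Υ` is locally uniformly inner calm* in the fuzzy sense w.r.t. its domain at `x` in
direction `d`. -/
def LocallyUniformlyFuzzyInnerCalm (Υ : X → Set Y) (x d : X) : Prop :=
  ∃ U ∈ 𝓝 x, ∃ N ∈ 𝓝 d, ∃ κ : ℝ, 0 < κ ∧ ∀ x' ∈ U ∩ dom Υ, ∀ d' ∈ N,
    FuzzyInnerCalm Υ x' d' ∧ fuzzyInnerCalmModulus Υ x' d' ≤ κ

end SetValued

section Model

variable {n m : ℕ}

/-- The composite function `f(x, u) = f₀(x) + g(F(x) + u)`. -/
def composite (f₀ : R n → ℝ) (F : R n → R m) (g : R m → EReal) : L2Prod (R n) (R m) → EReal :=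
  fun p => (f₀ p.fst : EReal) + g (F p.fst + p.snd)

/-- The mapping `M(v, u) = {x | v ∈ ∂ₓ f(x, u)}`, with `∂ₓ f(x, u)` the limiting subdifferential
of `f(·, u)` at `x`. -/
def mapM (f : L2Prod (R n) (R m) → EReal) : L2Prod (R n) (R m) → Set (R n) :=
  fun p => {x | p.fst ∈ subdiff (fun x' => f (pair x' p.snd)) x}

/-- The multiplier mapping `Y(v, u, x) = {y | (v, y) ∈ ∂f(x, u)}`. The argument `(v, u, x)` is
represented as `((v, u), x)`. -/
def mapY (f : L2Prod (R n) (R m) → EReal) : L2Prod (L2Prod (R n) (R m)) (R n) → Set (R m) :=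
  fun q => {y | pair q.fst.fst y ∈ subdiff f (pair q.snd q.fst.snd)}

/-- The Lagrangian `L(x, y) = f₀(x) + yᵀ F(x)`. -/
def lagrangian (f₀ : R n → ℝ) (F : R n → R m) (x : R n) (y : R m) : ℝ :=
  f₀ x + inner ℝ y (F x)

/-- The Hessian `∇²ₓₓ L(x, y)`, as a linear map. -/
def hessLagrangian (f₀ : R n → ℝ) (F : R n → R m) (x : R n) (y : R m) : R n →L[ℝ] R n :=
  fderiv ℝ (fun x' => gradient (fun x'' => lagrangian f₀ F x'' y) x') x

/-- The multiplier `y` is strongly noncritical for `x`. -/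
def StronglyNoncritical (f₀ : R n → ℝ) (F : R n → R m) (g : R m → EReal) (x : R n) (y : R m) :
    Prop :=
  ∀ (dx : R n) (dy : R m),
    hessLagrangian f₀ F x y dx + ContinuousLinearMap.adjoint (fderiv ℝ F x) dy = 0 →
    dy ∈ limitingGraphicalDeriv (subdiff g) (F x) y (fderiv ℝ F x dx) →
    dx = 0

/-- The basic qualification condition at `x` for the composite function:
`F'(x)ᵀ y = 0` and `y ∈ ∂^∞ g(F(x))` imply `y = 0`. -/
def BasicCQ (F : R n → R m) (g : R m → EReal) (x : R n) : Prop :=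
  ∀ y : R m, ContinuousLinearMap.adjoint (fderiv ℝ F x) y = 0 →
    y ∈ singularSubdiff g (F x) → y = 0

end Model

end CritMult

end

namespace CritMult


/-! Because `g` is convex, the multipliers are explicit: `y ∈ Y(v,u,x)` means that `y` is a convex
subgradient of `g` at `F x + u` and `v = ∇ₓL(x,y)` (`mem_mapY_iff`). No qualification condition is
needed for this, since `(x,u) ↦ F x + u` is a submersion. Always `dom Y ⊆ gph M`. Under the basic
qualification condition, which is stable under small perturbations, the two sets coincide near the
reference point.

Isolated calmness of `M` with constant `κ` is an estimate `‖dx‖ ≤ κ‖(dv,du)‖` on tangents to `gph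
M`. Tangents to `gph ∂g` produce tangents to `dom Y` by differentiating the formulas for `v` and `u`
(`mem_tangentCone_dom_mapY`). The reverse passage needs multipliers converging at a linear rate,
which is what fuzzy inner calmness* supplies (`exists_tangent_of_fuzzyInnerCalmConst`).

For (1) ⇒ (2), a direction violating strong noncriticality is a limit of tangents to `dom Y` whose
parameter part vanishes, so the estimate forces `dx = 0`. The same estimate excludes all directions
near `(0,0,dx)` from the tangent cones of `dom Y`, so inner calmness* holds vacuously.

For (2) ⇒ (1), failure of calmness gives tangents with `(dv,du) → 0` and `‖dx‖ = 1`. Inner calmness*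
bounds the associated multiplier directions, the qualification condition bounds the multipliers, and
a limit contradicts strong noncriticality (`exists_critical_of_tendsto`). -/

lemma tendsto_clm_apply {E H : Type*} [NormedAddCommGroup E] [NormedSpace ℝ E]
    [NormedAddCommGroup H] [NormedSpace ℝ H] {A : ℕ → E →L[ℝ] H} {A₀ : E →L[ℝ] H} {l : ℕ → E} {l₀ : E}
    (hA : Tendsto A atTop (𝓝 A₀)) (hl : Tendsto l atTop (𝓝 l₀)) :
    Tendsto (fun k => A k (l k)) atTop (𝓝 (A₀ l₀)) := by
  have h : Continuous fun q : (E →L[ℝ] H) × E => q.1 q.2 := by fun_prop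
  exact (h.tendsto (A₀, l₀)).comp (hA.prodMk_nhds hl)

/-! ### Normals to preimages of closed convex sets. -/

section NormalCones

variable {E H : Type*} [NormedAddCommGroup E] [InnerProductSpace ℝ E]
  [NormedAddCommGroup H] [InnerProductSpace ℝ H]

open ContinuousLinearMap (adjoint)

/-- The normal cone of convex analysis to `C` at `c`. -/
def convexNormalCone (C : Set H) (c : H) : Set H :=
  {l | ∀ c' ∈ C, inner ℝ l (c' - c) ≤ 0}

lemma mem_convexNormalCone_of_tendsto {C : Set H} {c l : ℕ → H} {c₀ l₀ : H}
    (hc : Tendsto c atTop (𝓝 c₀)) (hl : Tendsto l atTop (𝓝 l₀))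
    (h : ∀ k, l k ∈ convexNormalCone C (c k)) : l₀ ∈ convexNormalCone C c₀ := fun c' hc' =>
  le_of_tendsto (hl.inner (tendsto_const_nhds.sub hc)) (Eventually.of_forall fun k => h k c' hc')

lemma smul_mem_convexNormalCone {C : Set H} {c l : H} {t : ℝ} (ht : 0 ≤ t)
    (hl : l ∈ convexNormalCone C c) : t • l ∈ convexNormalCone C c := fun c' hc' => by
  rw [real_inner_smul_left]
  exact mul_nonpos_of_nonneg_of_nonpos ht (hl c' hc')

/-- First-order condition at a local minimizer of a smooth function plus `ε‖· - p‖`, read off from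
difference quotients along `p + c⁻¹ • w` as `c → ∞`. -/
lemma neg_mul_norm_le_of_eventually_le {θ : E → ℝ} {θ' : E →L[ℝ] ℝ} {p : E} {ε : ℝ}
    (hθ : HasFDerivAt θ θ' p) (hmin : ∀ᶠ x in 𝓝 p, θ p ≤ θ x + ε * ‖x - p‖) (w : E) :
    -(ε * ‖w‖) ≤ θ' w := by
  refine ge_of_tendsto (hθ.lim_real w) ?_
  have h0 : Tendsto (fun c : ℝ => p + c⁻¹ • w) atTop (𝓝 p) := by
    simpa using (tendsto_const_nhds (x := p)).add ((tendsto_inv_atTop_zero (𝕜 := ℝ)).smul_const w)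
  filter_upwards [h0.eventually hmin, eventually_gt_atTop 0] with c hc hc0
  rw [add_sub_cancel_left, norm_smul, norm_inv, Real.norm_of_nonneg hc0.le] at hc
  have : c * (ε * (c⁻¹ * ‖w‖)) = ε * ‖w‖ := by field_simp
  rw [smul_eq_mul]
  nlinarith

lemma norm_le_of_forall_inner {a : E} {ε : ℝ} (hε : 0 ≤ ε)
    (h : ∀ w, -(ε * ‖w‖) ≤ inner ℝ a w) : ‖a‖ ≤ ε := by
  by_contra! hlt
  have h1 := h (-a)
  rw [inner_neg_right, real_inner_self_eq_norm_sq, norm_neg] at h1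
  nlinarith

lemma regularNormalCone_subset_limitingNormalCone {D : Set E} {p : E} (hp : p ∈ D) :
    regularNormalCone D p ⊆ limitingNormalCone D p := fun η hη =>
  ⟨fun _ => p, fun _ => η, tendsto_const_nhds, tendsto_const_nhds, fun _ => ⟨hp, hη⟩⟩

variable [FiniteDimensional ℝ E] [FiniteDimensional ℝ H]

lemma tendsto_adjoint {A : ℕ → E →L[ℝ] H} {A₀ : E →L[ℝ] H} (hA : Tendsto A atTop (𝓝 A₀)) :
    Tendsto (fun k => adjoint (A k)) atTop (𝓝 (adjoint A₀)) := by
  have h := (adjoint (𝕜 := ℝ) (E := E) (F := H)).continuous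
  exact (h.tendsto A₀).comp hA

lemma tendsto_adjoint_apply {A : ℕ → E →L[ℝ] H} {A₀ : E →L[ℝ] H} {l : ℕ → H} {l₀ : H}
    (hA : Tendsto A atTop (𝓝 A₀)) (hl : Tendsto l atTop (𝓝 l₀)) :
    Tendsto (fun k => adjoint (A k) (l k)) atTop (𝓝 (adjoint A₀ l₀)) :=
  tendsto_clm_apply (tendsto_adjoint hA) hl

/-- If `A k → A₀` and `(A k)ᵀ (l k)` converges, then either a subsequence of `l` converges, or a
subsequence of the normalized sequence converges to a unit vector in the kernel of `A₀ᵀ`. -/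
theorem exists_subseq_or_kernel {A : ℕ → E →L[ℝ] H} {A₀ : E →L[ℝ] H} {l : ℕ → H} {η₀ : E}
    (hA : Tendsto A atTop (𝓝 A₀)) (hη : Tendsto (fun k => adjoint (A k) (l k)) atTop (𝓝 η₀)) :
    (∃ (φ : ℕ → ℕ) (l₀ : H), StrictMono φ ∧ Tendsto (l ∘ φ) atTop (𝓝 l₀)) ∨
    ∃ (φ : ℕ → ℕ) (l₀ : H), StrictMono φ ∧ ‖l₀‖ = 1 ∧ adjoint A₀ l₀ = 0 ∧
      Tendsto (fun k => ‖l (φ k)‖⁻¹) atTop (𝓝 0) ∧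
      Tendsto (fun k => ‖l (φ k)‖⁻¹ • l (φ k)) atTop (𝓝 l₀) := by
  -- If the norms do not tend to infinity, some ball is visited infinitely often and compactness
  -- gives the first alternative.
  by_cases hb : Tendsto (fun k => ‖l k‖) atTop atTop
  · right
    have hbd : ∀ k, ‖l k‖⁻¹ • l k ∈ Metric.closedBall (0 : H) 1 := fun k => by
      rw [mem_closedBall_zero_iff, norm_smul, norm_inv, norm_norm]
      exact inv_mul_le_one
    obtain ⟨l₀, -, φ, hφ, hlim⟩ := tendsto_subseq_of_bounded Metric.isBounded_closedBall hbd
    have hinv : Tendsto (fun k => ‖l (φ k)‖⁻¹) atTop (𝓝 0) :=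
      (tendsto_inv_atTop_zero.comp hb).comp hφ.tendsto_atTop
    refine ⟨φ, l₀, hφ, ?_, ?_, hinv, hlim⟩
    · refine tendsto_nhds_unique hlim.norm (tendsto_const_nhds.congr' ?_)
      filter_upwards [(hb.comp hφ.tendsto_atTop).eventually_gt_atTop 0] with k hk
      have hk' : 0 < ‖l (φ k)‖ := hk
      simp only [Function.comp_apply, norm_smul, norm_inv, norm_norm]
      exact (inv_mul_cancel₀ hk'.ne').symm
    · refine tendsto_nhds_unique (tendsto_adjoint_apply (hA.comp hφ.tendsto_atTop) hlim) ?_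
      have := hinv.smul (hη.comp hφ.tendsto_atTop)
      rw [zero_smul] at this
      refine this.congr fun k => ?_
      simp
  · left
    rw [tendsto_atTop] at hb
    push Not at hb
    obtain ⟨R, hR⟩ := hb
    obtain ⟨l₀, -, φ, hφ, hlim⟩ := tendsto_subseq_of_frequently_bounded
      (Metric.isBounded_closedBall (x := (0 : H)) (r := R)) (x := l)
      (hR.mono fun k hk => mem_closedBall_zero_iff.2 hk.le)
    exact ⟨φ, l₀, hφ, hlim⟩

/-- The qualification condition rules out escape to infinity: normalized normals would converge to a
unit normal in the kernel of `A₀ᵀ`. -/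
theorem exists_convexNormal_of_tendsto {C : Set H} {A : ℕ → E →L[ℝ] H} {A₀ : E →L[ℝ] H}
    {c l : ℕ → H} {c₀ : H} {η₀ : E}
    (hA : Tendsto A atTop (𝓝 A₀)) (hc : Tendsto c atTop (𝓝 c₀))
    (hl : ∀ k, l k ∈ convexNormalCone C (c k))
    (hη : Tendsto (fun k => adjoint (A k) (l k)) atTop (𝓝 η₀))
    (hCQ : ∀ l ∈ convexNormalCone C c₀, adjoint A₀ l = 0 → l = 0) :
    ∃ l ∈ convexNormalCone C c₀, adjoint A₀ l = η₀ := by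
  rcases exists_subseq_or_kernel hA hη with ⟨φ, l₀, hφ, hlim⟩ | ⟨φ, l₀, hφ, h1, h0, -, hlim⟩
  · exact ⟨l₀, mem_convexNormalCone_of_tendsto (hc.comp hφ.tendsto_atTop) hlim fun k => hl _,
      tendsto_nhds_unique (tendsto_adjoint_apply (hA.comp hφ.tendsto_atTop) hlim)
        (hη.comp hφ.tendsto_atTop)⟩
  · have := hCQ l₀ (mem_convexNormalCone_of_tendsto (hc.comp hφ.tendsto_atTop) hlim fun k =>
      smul_mem_convexNormalCone (inv_nonneg.2 (norm_nonneg _)) (hl _)) h0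
    simp [this] at h1

lemma exists_projection {C : Set H} (hC : IsClosed C) (hconv : Convex ℝ C) (hne : C.Nonempty)
    (z : H) : ∃ c ∈ C, ‖z - c‖ = Metric.infDist z C ∧ z - c ∈ convexNormalCone C c := by
  obtain ⟨c, hc, hd⟩ := hC.exists_infDist_eq_dist hne z
  rw [dist_eq_norm] at hd
  refine ⟨c, hc, hd.symm, ?_⟩
  refine (norm_eq_iInf_iff_real_inner_le_zero hconv hc).1 ?_
  rw [← hd, Metric.infDist_eq_iInf]
  simp only [dist_eq_norm]

/-- Regular normals to a preimage of a closed convex set are approximated by images of normals to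
the set under the adjoint derivative at nearby points. -/
theorem exists_approx_normal {G : E → H} (hG : Differentiable ℝ G) {C : Set H} (hC : IsClosed C)
    (hconv : Convex ℝ C) {p η : E} (hp : G p ∈ C) (hη : η ∈ regularNormalCone (G ⁻¹' C) p)
    {ε : ℝ} (hε : 0 < ε) :
    ∃ (p' : E) (c' l : H), ‖p' - p‖ < ε ∧ ‖c' - G p‖ < ε ∧ l ∈ convexNormalCone C c' ∧
      ‖adjoint (fderiv ℝ G p') l - η‖ ≤ ε := by
  have hne : C.Nonempty := ⟨_, hp⟩
  obtain ⟨r, hr, hball⟩ : ∃ r > 0, ∀ x, ‖x - p‖ ≤ r → G x ∈ C →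
      inner ℝ η (x - p) ≤ ε / 2 * ‖x - p‖ := by
    have := hη (ε / 2) (half_pos hε)
    rw [eventually_nhdsWithin_iff, Metric.eventually_nhds_iff] at this
    obtain ⟨r, hr, h⟩ := this
    refine ⟨r / 2, half_pos hr, fun x hx hxC => h ?_ hxC⟩
    rw [dist_eq_norm]; linarith
  have hGc : Continuous G := hG.continuous
  have hdc : Continuous fun x => Metric.infDist (G x) C :=
    (Metric.continuous_infDist_pt C).comp hGc
  have hd0 : Metric.infDist (G p) C = 0 := Metric.infDist_zero_of_mem hp
  -- Penalization: `q` is nonnegative on the preimage near `p`, because `η` is a regular normal.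
  -- Minimizing `q` plus `k/2` times the squared distance of `G x` to `C` therefore yields
  -- minimizers that cluster at `p` as `k → ∞`.
  set q : E → ℝ := fun x => -inner ℝ η (x - p) + ε * ‖x - p‖ with hq
  have hqc : Continuous q := by fun_prop
  have hqp : q p = 0 := by simp [hq]
  have hex : ∀ k : ℕ, ∃ x ∈ Metric.closedBall p r, ∀ x' ∈ Metric.closedBall p r,
      q x + k / 2 * Metric.infDist (G x) C ^ 2 ≤ q x' + k / 2 * Metric.infDist (G x') C ^ 2 :=
    fun k => by
      simpa only [isMinOn_iff] using (isCompact_closedBall p r).exists_isMinOn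
        (f := fun x => q x + k / 2 * Metric.infDist (G x) C ^ 2)
        ⟨p, Metric.mem_closedBall_self hr.le⟩
        (Continuous.continuousOn (by fun_prop))
  choose x hxb hxmin using hex
  have hle0 : ∀ k : ℕ, q (x k) + k / 2 * Metric.infDist (G (x k)) C ^ 2 ≤ 0 := fun k => by
    simpa [hqp, hd0] using hxmin k p (Metric.mem_closedBall_self hr.le)
  obtain ⟨x₀, hx₀b, φ, hφ, hlim⟩ := (isCompact_closedBall p r).tendsto_subseq hxb
  have hqx₀ : q x₀ ≤ 0 := by
    refine le_of_tendsto ((hqc.tendsto x₀).comp hlim) (Eventually.of_forall fun k => ?_)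
    have h1 := hle0 (φ k)
    have h2 : (0 : ℝ) ≤ (φ k : ℕ) / 2 * Metric.infDist (G (x (φ k))) C ^ 2 := by positivity
    simp only [Function.comp_apply]
    linarith
  have hx₀C : G x₀ ∈ C := by
    rw [hC.mem_iff_infDist_zero hne]
    have h1 : Tendsto (fun k => (2 * -q (x (φ k))) * ((φ k : ℝ))⁻¹) atTop (𝓝 0) := by
      have := (((hqc.tendsto x₀).comp hlim).neg.const_mul 2).mul
        ((tendsto_inv_atTop_zero.comp tendsto_natCast_atTop_atTop).comp hφ.tendsto_atTop)
      simpa using this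
    have h2 : Metric.infDist (G x₀) C ^ 2 ≤ 0 := by
      refine le_of_tendsto_of_tendsto (((hdc.tendsto x₀).comp hlim).pow 2) h1 ?_
      filter_upwards [hφ.tendsto_atTop.eventually_gt_atTop 0] with k hk
      have hk' : (0 : ℝ) < (φ k : ℝ) := by exact_mod_cast hk
      have := hle0 (φ k)
      simp only [Function.comp_apply]
      rw [← div_eq_mul_inv, le_div_iff₀ hk']
      linarith
    exact pow_eq_zero_iff two_ne_zero |>.1 (le_antisymm h2 (sq_nonneg _))
  have hx₀ : x₀ = p := by
    have h1 := hball x₀ (by simpa [dist_eq_norm] using hx₀b) hx₀C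
    have h2 : ε / 2 * ‖x₀ - p‖ ≤ 0 := by
      simp only [hq] at hqx₀; linarith
    have h3 : ‖x₀ - p‖ ≤ 0 := by nlinarith [half_pos hε]
    exact sub_eq_zero.1 (norm_le_zero_iff.1 h3)
  rw [hx₀] at hlim
  have hnear : ∀ᶠ k in atTop, ‖x (φ k) - p‖ < min ε r ∧ 2 * ‖G (x (φ k)) - G p‖ < ε := by
    have h1 : Tendsto (fun k => ‖x (φ k) - p‖) atTop (𝓝 0) := by
      simpa using (hlim.sub_const p).norm
    have h2 : Tendsto (fun k => 2 * ‖G (x (φ k)) - G p‖) atTop (𝓝 0) := by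
      simpa using ((((hGc.tendsto p).comp hlim).sub_const (G p)).norm).const_mul 2
    exact (h1.eventually_lt_const (lt_min hε hr)).and (h2.eventually_lt_const hε)
  obtain ⟨k, hk1, hk2⟩ := hnear.exists
  set p' := x (φ k)
  obtain ⟨c, hcC, hcd, hcN⟩ := exists_projection hC hconv hne (G p')
  have hcN' := smul_mem_convexNormalCone (t := (φ k : ℝ)) (by positivity) hcN
  refine ⟨p', c, (φ k : ℝ) • (G p' - c), hk1.trans_le (min_le_left _ _), ?_, hcN', ?_⟩
  · have h1 : ‖G p' - c‖ ≤ ‖G p' - G p‖ := by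
      rw [hcd, ← dist_eq_norm]; exact Metric.infDist_le_dist_of_mem hp
    have h2 : ‖c - G p‖ ≤ ‖c - G p'‖ + ‖G p' - G p‖ := norm_sub_le_norm_sub_add_norm_sub _ _ _
    rw [norm_sub_rev c (G p')] at h2
    linarith
  -- The squared distance is replaced by the smooth majorant `‖G y - c‖ ^ 2`, with `c` the
  -- projection of `G p'`; both agree at `p'`, so `p'` stays a local minimizer. The remaining term
  -- `ε‖· - p‖` is `ε`-Lipschitz and costs the error `ε`.
  · have hder : HasFDerivAt (fun y => -inner ℝ η y + (φ k : ℝ) / 2 * ‖G y - c‖ ^ 2)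
        (innerSL ℝ (adjoint (fderiv ℝ G p') ((φ k : ℝ) • (G p' - c)) - η)) p' := by
      have h1 : HasFDerivAt (fun y : E => inner ℝ η y) (innerSL ℝ η) p' :=
        (innerSL ℝ η).hasFDerivAt
      have h2 := ((hG p').hasFDerivAt.sub_const c).norm_sq
      refine (h1.neg.add (h2.const_mul ((φ k : ℝ) / 2))).congr_fderiv ?_
      ext w
      simp [ContinuousLinearMap.adjoint_inner_left]
      ring
    refine norm_le_of_forall_inner hε.le fun w => neg_mul_norm_le_of_eventually_le hder ?_ w
    have hmem : Metric.closedBall p r ∈ 𝓝 p' := by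
      refine mem_of_superset (Metric.isOpen_ball.mem_nhds ?_) Metric.ball_subset_closedBall
      rw [Metric.mem_ball, dist_eq_norm]
      exact hk1.trans_le (min_le_right _ _)
    filter_upwards [hmem] with y hy
    have h1 := hxmin (φ k) y hy
    have h2 : Metric.infDist (G y) C ≤ ‖G y - c‖ := by
      rw [← dist_eq_norm]; exact Metric.infDist_le_dist_of_mem hcC
    have h3 : (φ k : ℝ) / 2 * Metric.infDist (G y) C ^ 2 ≤ (φ k : ℝ) / 2 * ‖G y - c‖ ^ 2 := by
      have := Metric.infDist_nonneg (x := G y) (s := C)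
      gcongr
    have h4 : ‖y - p‖ ≤ ‖y - p'‖ + ‖p' - p‖ := norm_sub_le_norm_sub_add_norm_sub _ _ _
    have h5 : q p' = -inner ℝ η p' + inner ℝ η p + ε * ‖p' - p‖ := by
      simp only [hq, inner_sub_right]; ring
    have h6 : q y = -inner ℝ η y + inner ℝ η p + ε * ‖y - p‖ := by
      simp only [hq, inner_sub_right]; ring
    change q p' + _ * Metric.infDist (G p') C ^ 2 ≤ _ at h1
    rw [← hcd] at h1
    nlinarith

/-- The chain rule for limiting normals to the preimage of a closed convex set. -/
theorem exists_convexNormal_of_mem_limitingNormalCone {G : E → H} (hG : ContDiff ℝ 1 G) {C : Set H}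
    (hC : IsClosed C) (hconv : Convex ℝ C) {p η : E}
    (hCQ : ∀ l ∈ convexNormalCone C (G p), adjoint (fderiv ℝ G p) l = 0 → l = 0)
    (hη : η ∈ limitingNormalCone (G ⁻¹' C) p) :
    ∃ l ∈ convexNormalCone C (G p), adjoint (fderiv ℝ G p) l = η := by
  obtain ⟨pk, ηk, hpk, hηk, hk⟩ := hη
  have hGd : Differentiable ℝ G := hG.differentiable one_ne_zero
  choose p' c' l hp' hc' hl hlη using fun k : ℕ => exists_approx_normal hGd hC hconv (hk k).1
    (hk k).2 (Nat.one_div_pos_of_nat (α := ℝ) (n := k))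
  have hz := tendsto_one_div_add_atTop_nhds_zero_nat (𝕜 := ℝ)
  have hp'lim : Tendsto p' atTop (𝓝 p) := by
    have := (squeeze_zero_norm (fun k => (hp' k).le) hz).add hpk
    simpa using this
  have hc'lim : Tendsto c' atTop (𝓝 (G p)) := by
    have := (squeeze_zero_norm (fun k => (hc' k).le) hz).add ((hGd.continuous.tendsto p).comp hpk)
    simpa using this
  have hηlim : Tendsto (fun k => adjoint (fderiv ℝ G (p' k)) (l k)) atTop (𝓝 η) := by
    have := (squeeze_zero_norm hlη hz).add hηk
    simpa using this
  exact exists_convexNormal_of_tendsto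
    (((hG.continuous_fderiv one_ne_zero).tendsto p).comp hp'lim) hc'lim hl hηlim hCQ

/-- This inclusion needs no qualification condition: the convex normal inequality at `G x` differs
from its linearization by `o(‖x - p‖)`. -/
theorem adjoint_mem_regularNormalCone {G : E → H} {p : E} (hG : DifferentiableAt ℝ G p) {C : Set H}
    {l : H} (hl : l ∈ convexNormalCone C (G p)) :
    adjoint (fderiv ℝ G p) l ∈ regularNormalCone (G ⁻¹' C) p := by
  intro ε hε
  have h := hG.hasFDerivAt.isLittleO.def (c := ε / (‖l‖ + 1)) (by positivity)
  filter_upwards [self_mem_nhdsWithin, mem_nhdsWithin_of_mem_nhds h] with x hxC hx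
  have h1 := hl _ hxC
  rw [ContinuousLinearMap.adjoint_inner_left]
  have h2 : inner ℝ l (fderiv ℝ G p (x - p)) =
      inner ℝ l (G x - G p) - inner ℝ l (G x - G p - fderiv ℝ G p (x - p)) := by
    rw [← inner_sub_right]; simp
  have h3 := neg_le_of_abs_le (abs_real_inner_le_norm l (G x - G p - fderiv ℝ G p (x - p)))
  have h4 : ‖l‖ * ‖G x - G p - fderiv ℝ G p (x - p)‖ ≤ ε * ‖x - p‖ := by
    calc _ ≤ (‖l‖ + 1) * (ε / (‖l‖ + 1) * ‖x - p‖) := by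
          gcongr; linarith
      _ = _ := by field_simp
  linarith

end NormalCones


/-! ### Subgradients and the chain rule through epigraphs. -/

section Subgradients

open ContinuousLinearMap (adjoint)

@[simp] lemma pair_fst {X Y : Type*} (x : X) (y : Y) : (pair x y).fst = x := rfl

@[simp] lemma pair_snd {X Y : Type*} (x : X) (y : Y) : (pair x y).snd = y := rfl

lemma isProper_exists_coe {H : Type*} {g : H → EReal} (hg : IsProper g) {z : H} (hz : g z ≠ ⊤) :
    ∃ a : ℝ, g z = a :=
  ⟨(g z).toReal, (EReal.coe_toReal hz (hg.2 z).ne').symm⟩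

lemma coe_add_le_coe_iff {a c : ℝ} {b : EReal} :
    (a : EReal) + b ≤ c ↔ b ≤ ((c - a : ℝ) : EReal) := by
  induction b with
  | bot => simp
  | top => simp [-EReal.coe_sub]
  | coe b => norm_cast; exact ⟨fun h => by linarith, fun h => by linarith⟩

lemma coe_add_ne_bot {H : Type*} {g : H → EReal} (hg : IsProper g) (a : ℝ) (z : H) : (a : EReal) + g z ≠ ⊥ := by
  simpa [EReal.add_eq_bot_iff] using (hg.2 z).ne'

lemma coe_add_ne_top {a : ℝ} {b : EReal} : (a : EReal) + b ≠ ⊤ ↔ b ≠ ⊤ := by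
  induction b with
  | bot => simp
  | top => simp
  | coe b => rw [← EReal.coe_add]; simp [-EReal.coe_add]

variable {E H : Type*} {φ₀ : E → ℝ} {Φ : E → H} {g : H → EReal}

/-- The map under which the epigraph of `φ₀ + g ∘ Φ` is the preimage of the epigraph of `g`. -/
def epiMap (φ₀ : E → ℝ) (Φ : E → H) : L2Prod E ℝ → L2Prod H ℝ :=
  fun p => pair (Φ p.fst) (p.snd - φ₀ p.fst)

lemma epi_add_comp : epi (fun e => (φ₀ e : EReal) + g (Φ e)) = epiMap φ₀ Φ ⁻¹' epi g :=
  Set.ext fun _ => coe_add_le_coe_iff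

lemma epiMap_pair_toReal (hg : IsProper g) {e : E} (he : g (Φ e) ≠ ⊤) :
    epiMap φ₀ Φ (pair e ((φ₀ e : EReal) + g (Φ e)).toReal) =
      pair (Φ e) (g (Φ e)).toReal := by
  obtain ⟨b, hb⟩ := isProper_exists_coe hg he
  simp only [epiMap, pair_fst, pair_snd, hb, ← EReal.coe_add, EReal.toReal_coe]
  congr 2
  ring

variable [NormedAddCommGroup E] [NormedAddCommGroup H]

lemma isClosed_epi (hg : LowerSemicontinuous g) : IsClosed (epi g) :=
  hg.isClosed_epigraph.preimage (f := fun p : L2Prod H ℝ => (p.fst, (p.snd : EReal)))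
    ((WithLp.continuous_fst 2 H ℝ).prodMk (continuous_coe_real_ereal.comp
      (WithLp.continuous_snd 2 H ℝ)))

variable [InnerProductSpace ℝ E] [InnerProductSpace ℝ H]

/-- `y` is a subgradient of `g` at `z` in the sense of convex analysis. -/
def IsSubgradient (g : H → EReal) (z y : H) : Prop :=
  ∀ (z' : H) (a : ℝ), g z' ≤ a → g z ≤ ((a - inner ℝ y (z' - z) : ℝ) : EReal)

/-- With real upper bounds `a` of `g z'`, the subgradient inequality says that `(z, a - ⟪y, z' -
z⟫)` lies in the epigraph. Its closedness suffices; the values of `g` along the sequence need not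
converge. -/
lemma isSubgradient_of_tendsto (hg : LowerSemicontinuous g) {z y : ℕ → H}
    {z₀ y₀ : H} (hz : Tendsto z atTop (𝓝 z₀)) (hy : Tendsto y atTop (𝓝 y₀))
    (h : ∀ k, IsSubgradient g (z k) (y k)) : IsSubgradient g z₀ y₀ := by
  intro z' a ha
  have h1 : Tendsto (fun k => (pair (z k) (a - inner ℝ (y k) (z' - z k)) : L2Prod H ℝ)) atTop
      (𝓝 (pair z₀ (a - inner ℝ y₀ (z' - z₀)))) :=
    ((WithLp.prod_continuous_toLp 2 H ℝ).tendsto _).comp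
      (hz.prodMk_nhds (tendsto_const_nhds.sub (hy.inner (tendsto_const_nhds.sub hz))))
  exact (isClosed_epi hg).mem_of_tendsto h1 (Eventually.of_forall fun k => h k z' a ha)

lemma IsSubgradient.ne_top (hg : IsProper g) {z y : H}
    (h : IsSubgradient g z y) : g z ≠ ⊤ := by
  obtain ⟨z', hz'⟩ := hg.1
  obtain ⟨a, ha⟩ := isProper_exists_coe hg hz'.ne
  exact ne_top_of_le_ne_top (EReal.coe_ne_top _) (h z' a ha.le)

lemma inner_l2Prod (p q : L2Prod H ℝ) :
    inner ℝ p q = inner ℝ p.fst q.fst + p.snd * q.snd := by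
  rw [WithLp.prod_inner_apply]
  simp [mul_comm]

lemma isSubgradient_iff (hg : IsProper g) {z y : H} :
    IsSubgradient g z y ↔ g z ≠ ⊤ ∧
      pair y (-1 : ℝ) ∈ convexNormalCone (epi g) (pair z (g z).toReal) := by
  constructor
  · intro h
    obtain ⟨b, hb⟩ := isProper_exists_coe hg (h.ne_top hg)
    refine ⟨h.ne_top hg, fun c hc => ?_⟩
    have := h c.fst c.snd hc
    rw [hb, EReal.coe_le_coe_iff] at this
    simp only [inner_l2Prod, hb, EReal.toReal_coe, WithLp.sub_fst, WithLp.sub_snd,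
      pair_fst, pair_snd]
    linarith
  · rintro ⟨hz, h⟩ z' a ha
    obtain ⟨b, hb⟩ := isProper_exists_coe hg hz
    have := h (pair z' a) ha
    simp only [inner_l2Prod, hb, EReal.toReal_coe, WithLp.sub_fst, WithLp.sub_snd,
      pair_fst, pair_snd] at this
    rw [hb, EReal.coe_le_coe_iff]
    linarith

lemma contDiff_epiMap (hφ₀ : ContDiff ℝ 1 φ₀) (hΦ : ContDiff ℝ 1 Φ) :
    ContDiff ℝ 1 (epiMap φ₀ Φ) := by
  have h1 : ContDiff ℝ 1 fun p : L2Prod E ℝ => p.fst :=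
    (WithLp.prodContinuousLinearEquiv 2 ℝ E ℝ).contDiff.fst
  have h2 : ContDiff ℝ 1 fun p : L2Prod E ℝ => p.snd :=
    (WithLp.prodContinuousLinearEquiv 2 ℝ E ℝ).contDiff.snd
  exact (WithLp.prodContinuousLinearEquiv 2 ℝ H ℝ).symm.contDiff.comp
    ((hΦ.comp h1).prodMk (h2.sub (hφ₀.comp h1)))

lemma fderiv_epiMap {p : L2Prod E ℝ} (hφ₀ : DifferentiableAt ℝ φ₀ p.fst)
    (hΦ : DifferentiableAt ℝ Φ p.fst) (w : L2Prod E ℝ) :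
    fderiv ℝ (epiMap φ₀ Φ) p w =
      pair (fderiv ℝ Φ p.fst w.fst) (w.snd - fderiv ℝ φ₀ p.fst w.fst) := by
  have h0 := (WithLp.prodContinuousLinearEquiv 2 ℝ E ℝ).hasFDerivAt (x := p)
  have h1 : HasFDerivAt (fun p : L2Prod E ℝ => p.fst) _ p := h0.fst
  have h2 : HasFDerivAt (fun p : L2Prod E ℝ => p.snd) _ p := h0.snd
  have h3 := (WithLp.prodContinuousLinearEquiv 2 ℝ H ℝ).symm.hasFDerivAt.comp p
    ((hΦ.hasFDerivAt.comp p h1).prodMk (h2.sub (hφ₀.hasFDerivAt.comp p h1)))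
  have h4 : HasFDerivAt (epiMap φ₀ Φ) _ p := h3
  rw [h4.fderiv]
  rfl

variable [FiniteDimensional ℝ E] [FiniteDimensional ℝ H]

lemma inner_gradient (φ₀ : E → ℝ) (x w : E) :
    inner ℝ (gradient φ₀ x) w = fderiv ℝ φ₀ x w := by
  simp [gradient]

lemma adjoint_fderiv_epiMap {p : L2Prod E ℝ} (hφ₀ : DifferentiableAt ℝ φ₀ p.fst)
    (hΦ : DifferentiableAt ℝ Φ p.fst) (l : L2Prod H ℝ) :
    adjoint (fderiv ℝ (epiMap φ₀ Φ) p) l =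
      pair (adjoint (fderiv ℝ Φ p.fst) l.fst - l.snd • gradient φ₀ p.fst) l.snd := by
  refine ext_inner_right ℝ fun w => ?_
  rw [ContinuousLinearMap.adjoint_inner_left, fderiv_epiMap hφ₀ hΦ]
  simp only [inner_l2Prod, pair_fst, pair_snd, inner_sub_left, real_inner_smul_left,
    ContinuousLinearMap.adjoint_inner_left, inner_gradient]
  ring

/-- Subgradients of the outer convex function yield subgradients of the composition. -/
theorem mem_subdiff_add_comp (hφ₀ : ContDiff ℝ 1 φ₀) (hΦ : ContDiff ℝ 1 Φ) (hg : IsProper g)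
    {e : E} {y : H} (hy : IsSubgradient g (Φ e) y) :
    gradient φ₀ e + adjoint (fderiv ℝ Φ e) y ∈
      subdiff (fun e => (φ₀ e : EReal) + g (Φ e)) e := by
  obtain ⟨hz, hN⟩ := (isSubgradient_iff hg).1 hy
  refine ⟨coe_add_ne_top.2 hz, coe_add_ne_bot hg _ _, ?_⟩
  set p : L2Prod E ℝ := pair e ((φ₀ e : EReal) + g (Φ e)).toReal with hp
  rw [← epiMap_pair_toReal (φ₀ := φ₀) hg hz] at hN
  have h1 := adjoint_mem_regularNormalCone
    (((contDiff_epiMap hφ₀ hΦ).differentiable one_ne_zero) p) hN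
  rw [adjoint_fderiv_epiMap (hφ₀.differentiable one_ne_zero _)
    (hΦ.differentiable one_ne_zero _), ← epi_add_comp] at h1
  refine regularNormalCone_subset_limitingNormalCone ?_ ?_
  · change (φ₀ e : EReal) + g (Φ e) ≤ ((((φ₀ e : EReal) + g (Φ e)).toReal : ℝ) : EReal)
    rw [EReal.coe_toReal (coe_add_ne_top.2 hz) (coe_add_ne_bot hg _ _)]
  · simpa [hp, add_comm] using h1

/-- The chain rule for the limiting subdifferential of `φ₀ + g ∘ Φ`, `g` convex, under the basic
qualification condition. -/
theorem exists_isSubgradient_of_mem_subdiff (hφ₀ : ContDiff ℝ 1 φ₀) (hΦ : ContDiff ℝ 1 Φ)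
    (hg : IsProper g) (hlsc : LowerSemicontinuous g) (hconv : IsConvex g) {e v : E}
    (hCQ : ∀ y ∈ convexNormalCone {z | g z < ⊤} (Φ e), adjoint (fderiv ℝ Φ e) y = 0 → y = 0)
    (hv : v ∈ subdiff (fun e => (φ₀ e : EReal) + g (Φ e)) e) :
    ∃ y, IsSubgradient g (Φ e) y ∧ v = gradient φ₀ e + adjoint (fderiv ℝ Φ e) y := by
  obtain ⟨htop, -, hN⟩ := hv
  have hz : g (Φ e) ≠ ⊤ := coe_add_ne_top.1 htop
  set p : L2Prod E ℝ := pair e ((φ₀ e : EReal) + g (Φ e)).toReal with hp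
  have hadj := adjoint_fderiv_epiMap (p := p) (hφ₀.differentiable one_ne_zero _)
    (hΦ.differentiable one_ne_zero _)
  have hGp : epiMap φ₀ Φ p = _ := epiMap_pair_toReal (φ₀ := φ₀) hg hz
  rw [epi_add_comp] at hN
  -- A normal annihilated by the adjoint has zero vertical component, so its horizontal part is
  -- normal to the effective domain of `g`, where the assumed condition applies.
  have hCQ' : ∀ l ∈ convexNormalCone (epi g) (epiMap φ₀ Φ p),
      adjoint (fderiv ℝ (epiMap φ₀ Φ) p) l = 0 → l = 0 := by
    intro l hl h0
    rw [hadj] at h0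
    have h2 : l.snd = 0 := congrArg WithLp.snd h0
    have h1 := congrArg WithLp.fst h0
    have h3 : l.fst = 0 := by
      refine hCQ _ (fun z' hz' => ?_) (by simpa [hp, h2] using h1)
      obtain ⟨a, ha⟩ := isProper_exists_coe hg (ne_of_lt hz')
      have := hl (pair z' a) ha.le
      rw [hGp, inner_l2Prod, h2] at this
      simpa using this
    have : l = pair l.fst l.snd := rfl
    rw [this, h2, h3]
    rfl
  obtain ⟨l, hl, hle⟩ := exists_convexNormal_of_mem_limitingNormalCone (contDiff_epiMap hφ₀ hΦ)
    (isClosed_epi hlsc) hconv hCQ' hN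
  rw [hadj] at hle
  have h1 := congrArg WithLp.fst hle
  have h2 : l.snd = -1 := congrArg WithLp.snd hle
  simp only [h2, pair_fst] at h1
  refine ⟨l.fst, (isSubgradient_iff hg).2 ⟨hz, ?_⟩, ?_⟩
  · rw [← h2, ← hGp]; exact hl
  · rw [← h1]; simp [hp, add_comm]

lemma adjoint_id_apply (y : H) : adjoint (ContinuousLinearMap.id ℝ H) y = y :=
  ext_inner_right ℝ fun w => by simp [ContinuousLinearMap.adjoint_inner_left]

/-- The chain rule with `φ₀ = 0` and `Φ = id`, for which the qualification condition is trivial. -/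
theorem mem_subdiff_iff_isSubgradient (hg : IsProper g) (hlsc : LowerSemicontinuous g)
    (hconv : IsConvex g) {z y : H} : y ∈ subdiff g z ↔ IsSubgradient g z y := by
  have h0 : (fun e => ((0 : ℝ) : EReal) + g (id e)) = g := by ext; simp
  have hgr : gradient (fun _ : H => (0 : ℝ)) z = 0 :=
    ext_inner_right ℝ fun w => by simp
  constructor
  · intro hy
    rw [← h0] at hy
    obtain ⟨y', hy', h⟩ := exists_isSubgradient_of_mem_subdiff contDiff_const contDiff_id hg hlsc
      hconv (fun y _ h => by simpa [adjoint_id_apply] using h) hy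
    have : y = y' := by simpa [hgr, adjoint_id_apply] using h
    rwa [this]
  · intro hy
    have := mem_subdiff_add_comp (E := H) (φ₀ := fun _ => 0) (Φ := id) contDiff_const contDiff_id
      hg hy
    rw [h0] at this
    simpa [hgr, adjoint_id_apply] using this

/-- Links `BasicCQ` to the condition used in the chain rule. The epigraph projects into the
effective domain, so `(y, 0)` is normal to it whenever `y` is normal to the domain. -/
theorem mem_singularSubdiff_of_mem_convexNormalCone (hg : IsProper g) {z y : H}
    (hz : g z ≠ ⊤) (hy : y ∈ convexNormalCone {z | g z < ⊤} z) : y ∈ singularSubdiff g z := by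
  refine ⟨hz, (hg.2 z).ne', ?_⟩
  have hN : pair y (0 : ℝ) ∈ convexNormalCone (epi g) (id (pair z (g z).toReal)) := fun c hc => by
    rw [inner_l2Prod]
    simpa using hy c.fst (lt_of_le_of_lt hc (EReal.coe_lt_top _))
  have h1 := adjoint_mem_regularNormalCone differentiableAt_id hN
  refine regularNormalCone_subset_limitingNormalCone ?_ (by simpa [adjoint_id_apply] using h1)
  change g z ≤ ((g z).toReal : EReal)
  rw [EReal.coe_toReal hz (hg.2 z).ne']

end Subgradients


/-! ### Tangent directions and isolated calmness. -/

section Tangents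

variable {X Z : Type*} [NormedAddCommGroup X] [NormedSpace ℝ X]
  [NormedAddCommGroup Z] [NormedSpace ℝ Z]

lemma mem_tangentCone_of_eventually {C : Set X} {x d : X} {dk : ℕ → X} {tk : ℕ → ℝ}
    (hd : Tendsto dk atTop (𝓝 d)) (ht : ∀ k, 0 < tk k) (ht0 : Tendsto tk atTop (𝓝 0))
    (h : ∀ᶠ k in atTop, x + tk k • dk k ∈ C) : d ∈ tangentCone C x := by
  obtain ⟨N, hN⟩ := eventually_atTop.1 h
  exact ⟨fun k => dk (k + N), fun k => tk (k + N), (tendsto_add_atTop_iff_nat N).2 hd,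
    fun k => ht _, (tendsto_add_atTop_iff_nat N).2 ht0, fun k => hN _ (Nat.le_add_left _ _)⟩

lemma tendsto_add_smul {x d : X} {dk : ℕ → X} {tk : ℕ → ℝ} (hd : Tendsto dk atTop (𝓝 d))
    (ht0 : Tendsto tk atTop (𝓝 0)) : Tendsto (fun k => x + tk k • dk k) atTop (𝓝 x) := by
  simpa using tendsto_const_nhds.add (ht0.smul hd)

lemma tangentCone_mono_of_eventually {C D : Set X} {x d : X} (hd : d ∈ tangentCone C x)
    (h : ∀ᶠ x' in 𝓝 x, x' ∈ C → x' ∈ D) : d ∈ tangentCone D x := by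
  obtain ⟨dk, tk, hdk, ht, ht0, hC⟩ := hd
  refine mem_tangentCone_of_eventually hdk ht ht0 ?_
  filter_upwards [(tendsto_add_smul hdk ht0).eventually h] with k hk using hk (hC k)

lemma tendsto_difference_quotient {f : X → Z} {f' : X →L[ℝ] Z} {x d : X}
    (hf : HasFDerivAt f f' x) {dk : ℕ → X} {tk : ℕ → ℝ} (hd : Tendsto dk atTop (𝓝 d))
    (ht : ∀ k, 0 < tk k) (ht0 : Tendsto tk atTop (𝓝 0)) :
    Tendsto (fun k => (tk k)⁻¹ • (f (x + tk k • dk k) - f x)) atTop (𝓝 (f' d)) := by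
  refine (hasFDerivWithinAt_univ.2 hf).lim ?_ (Eventually.of_forall fun _ => Set.mem_univ _) ?_
  · simpa using ht0.smul hd
  · refine hd.congr fun k => ?_
    rw [inv_smul_smul₀ (ht k).ne']

/-- At a point of isolated calmness with constant `κ`, tangent directions to the graph satisfy the
corresponding linear estimate. -/
lemma norm_snd_le_of_mem_tangentCone {Υ : X → Set Z} {κ : ℝ} {q : L2Prod X Z} {d : L2Prod X Z}
    (hcalm : IsolatedlyCalmAt Υ q.fst q.snd κ)
    (hd : d ∈ tangentCone {q : L2Prod X Z | q.snd ∈ Υ q.fst} q) : ‖d.snd‖ ≤ κ * ‖d.fst‖ := by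
  obtain ⟨V, hV, h⟩ := hcalm
  obtain ⟨dk, tk, hdk, ht, ht0, hC⟩ := hd
  have hfst := ((WithLp.continuous_fst 2 X Z).tendsto d).comp hdk
  have hsnd := ((WithLp.continuous_snd 2 X Z).tendsto d).comp hdk
  refine le_of_tendsto_of_tendsto hsnd.norm (hfst.norm.const_mul κ) ?_
  filter_upwards [(tendsto_add_smul (x := q.snd) hsnd ht0).eventually hV] with k hk
  have := h _ _ ⟨hC k, hk⟩
  simp only [WithLp.add_fst, WithLp.add_snd, WithLp.smul_fst, WithLp.smul_snd, add_sub_cancel_left,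
    norm_smul, Real.norm_of_nonneg (ht k).le] at this
  refine le_of_mul_le_mul_left ?_ (ht k)
  simp only [Function.comp_apply]
  linarith

/-- Failure of isolated calmness produces tangent directions violating the linear estimate. -/
lemma exists_tangent_of_not_isolatedlyCalmAt [FiniteDimensional ℝ X] [FiniteDimensional ℝ Z]
    {Υ : X → Set Z} {x : X} {z : Z} {κ : ℝ} (hκ : 0 < κ) (h : ¬ IsolatedlyCalmAt Υ x z κ) :
    ∃ (a : X) (b : Z), κ * ‖a‖ ≤ 1 ∧ ‖b‖ = 1 ∧
      pair a b ∈ tangentCone {q : L2Prod X Z | q.snd ∈ Υ q.fst} (pair x z) := by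
  unfold IsolatedlyCalmAt at h
  push Not at h
  choose xk zk hzk hlt using fun k : ℕ =>
    h (Metric.ball z (1 / ((k : ℝ) + 1))) (Metric.ball_mem_nhds _ Nat.one_div_pos_of_nat)
  -- Dividing by the displacement in `Z` gives unit vectors there, and the violated estimate bounds
  -- the scaled displacements in `X` by `κ⁻¹`.
  set t : ℕ → ℝ := fun k => ‖zk k - z‖
  have ht : ∀ k, 0 < t k := fun k => (by positivity : 0 ≤ κ * ‖xk k - x‖).trans_lt (hlt k)
  have ht0 : Tendsto t atTop (𝓝 0) := by
    refine squeeze_zero (fun k => (ht k).le) (fun k => ?_)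
      (tendsto_one_div_add_atTop_nhds_zero_nat (𝕜 := ℝ))
    have := (hzk k).2
    rw [Metric.mem_ball, dist_eq_norm] at this
    exact this.le
  set ak : ℕ → X := fun k => (t k)⁻¹ • (xk k - x)
  set bk : ℕ → Z := fun k => (t k)⁻¹ • (zk k - z)
  have hbk : ∀ k, ‖bk k‖ = 1 := fun k => by
    simp only [bk, norm_smul, norm_inv, Real.norm_of_nonneg (ht k).le]
    exact inv_mul_cancel₀ (ht k).ne'
  have hak : ∀ k, κ * ‖ak k‖ ≤ 1 := fun k => by
    simp only [ak, norm_smul, norm_inv, Real.norm_of_nonneg (ht k).le]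
    rw [mul_left_comm, inv_mul_le_iff₀ (ht k), mul_one]
    exact (hlt k).le
  have := FiniteDimensional.proper ℝ (X × Z)
  have hbd : ∀ k, (ak k, bk k) ∈ Metric.closedBall (0 : X) κ⁻¹ ×ˢ Metric.closedBall (0 : Z) 1 :=
    fun k => by
      simp only [Set.mem_prod, mem_closedBall_zero_iff, hbk, le_refl, and_true]
      rw [inv_eq_one_div, le_div_iff₀ hκ, mul_comm]
      exact hak k
  obtain ⟨⟨a, b⟩, -, φ, hφ, hlim⟩ := tendsto_subseq_of_bounded
    (Metric.isBounded_closedBall.prod Metric.isBounded_closedBall) hbd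
  have ha := (continuous_fst.tendsto _).comp hlim
  have hb := (continuous_snd.tendsto _).comp hlim
  refine ⟨a, b, le_of_tendsto (ha.norm.const_mul κ) (Eventually.of_forall fun k => hak _),
    tendsto_nhds_unique hb.norm (tendsto_const_nhds.congr fun k => (hbk _).symm),
    fun k => pair (ak (φ k)) (bk (φ k)), fun k => t (φ k),
    ((WithLp.prod_continuous_toLp 2 X Z).tendsto _).comp hlim, fun k => ht _,
    ht0.comp hφ.tendsto_atTop, fun k => ?_⟩
  have h1 : x + t (φ k) • ak (φ k) = xk (φ k) := by
    simp [ak, smul_inv_smul₀ (ht (φ k)).ne']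
  have h2 : z + t (φ k) • bk (φ k) = zk (φ k) := by
    simp [bk, smul_inv_smul₀ (ht (φ k)).ne']
  change z + t (φ k) • bk (φ k) ∈ Υ (x + t (φ k) • ak (φ k))
  rw [h1, h2]
  exact (hzk _).1

end Tangents

/-! ### The modulus of inner calmness* in the fuzzy sense. -/

section InnerCalmness

variable {X Z : Type*} [NormedAddCommGroup X] [NormedSpace ℝ X] [NormedAddCommGroup Z]

/-- The modulus is an infimum that need not be attained, hence the slack `1`. In a tangent direction
`FuzzyInnerCalm` makes the set of constants nonempty, so the infimum is not the default value of
`sInf ∅`. -/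
lemma exists_fuzzyInnerCalmConst {Υ : X → Set Z} {x d : X} {κ : ℝ} (h : FuzzyInnerCalm Υ x d)
    (hmod : fuzzyInnerCalmModulus Υ x d ≤ κ) (hd : d ∈ tangentCone (dom Υ) x) :
    ∃ κ' ≤ κ + 1, FuzzyInnerCalmConst Υ x d κ' := by
  rw [fuzzyInnerCalmModulus, if_pos hd] at hmod
  obtain ⟨κ', h1, h2⟩ := exists_lt_of_csInf_lt (h.resolve_left (not_not.2 hd))
    (hmod.trans_lt (lt_add_one κ))
  exact ⟨κ', h2.le, h1⟩

lemma fuzzyInnerCalm_of_notMem {Υ : X → Set Z} {x d : X} {κ : ℝ} (hκ : 0 ≤ κ)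
    (hd : d ∉ tangentCone (dom Υ) x) :
    FuzzyInnerCalm Υ x d ∧ fuzzyInnerCalmModulus Υ x d ≤ κ :=
  ⟨Or.inl hd, by rwa [fuzzyInnerCalmModulus, if_neg hd]⟩

end InnerCalmness

/-! ### The gradient of the Lagrangian as a function of both variables. -/

section Lagrangian

open ContinuousLinearMap (adjoint)

variable {n m : ℕ} {f₀ : R n → ℝ} {F : R n → R m}

/-- The gradient `∇ₓL(x, y) = ∇f₀(x) + F'(x)ᵀ y`, as a function of the pair `(x, y)`. -/
noncomputable def lagrangianGradient (f₀ : R n → ℝ) (F : R n → R m) : R n × R m → R n :=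
  fun p => gradient f₀ p.1 + adjoint (fderiv ℝ F p.1) p.2

/-- Coordinatewise, the adjoint can be moved to the other side of the inner product, leaving only
`fderiv ℝ f₀` and `fderiv ℝ F` applied to basis vectors. -/
lemma contDiff_lagrangianGradient (hf₀ : ContDiff ℝ 2 f₀) (hF : ContDiff ℝ 2 F) :
    ContDiff ℝ 1 (lagrangianGradient f₀ F) := by
  rw [contDiff_euclidean]
  intro i
  have h : (fun p => lagrangianGradient f₀ F p i) = fun p : R n × R m =>
      fderiv ℝ f₀ p.1 (EuclideanSpace.single i 1) +
        inner ℝ p.2 (fderiv ℝ F p.1 (EuclideanSpace.single i 1)) := by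
    ext p
    rw [← inner_gradient, ← ContinuousLinearMap.adjoint_inner_left, ← inner_add_left,
      EuclideanSpace.inner_single_right]
    simp [lagrangianGradient]
  rw [h]
  have h1 : ContDiff ℝ 1 fun p : R n × R m => fderiv ℝ f₀ p.1 :=
    (hf₀.fderiv_right (m := 1) (by norm_num)).comp contDiff_fst
  have h2 : ContDiff ℝ 1 fun p : R n × R m => fderiv ℝ F p.1 :=
    (hF.fderiv_right (m := 1) (by norm_num)).comp contDiff_fst
  exact (h1.clm_apply contDiff_const).add
    (contDiff_snd.inner ℝ (h2.clm_apply contDiff_const))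

lemma gradient_lagrangian (hf₀ : Differentiable ℝ f₀) (hF : Differentiable ℝ F) (x : R n)
    (y : R m) :
    gradient (fun x' => lagrangian f₀ F x' y) x = lagrangianGradient f₀ F (x, y) := by
  refine ext_inner_right ℝ fun w => ?_
  have h : HasFDerivAt (fun x' => lagrangian f₀ F x' y)
      (fderiv ℝ f₀ x + (innerSL ℝ y).comp (fderiv ℝ F x)) x :=
    (hf₀ x).hasFDerivAt.add ((innerSL ℝ y).hasFDerivAt.comp x (hF x).hasFDerivAt)
  rw [inner_gradient, h.fderiv, lagrangianGradient, inner_add_left, inner_gradient,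
    ContinuousLinearMap.adjoint_inner_left]
  rfl

/-- Since `∇ₓL` is affine in `y` with linear part `F'(x)ᵀ`, the expression in the noncriticality
condition is its total derivative. -/
lemma hessLagrangian_add (hf₀ : ContDiff ℝ 2 f₀) (hF : ContDiff ℝ 2 F) (x : R n) (y : R m)
    (dx : R n) (dy : R m) :
    hessLagrangian f₀ F x y dx + adjoint (fderiv ℝ F x) dy =
      fderiv ℝ (lagrangianGradient f₀ F) (x, y) (dx, dy) := by
  have hd := ((contDiff_lagrangianGradient hf₀ hF).differentiable one_ne_zero
    (x, y)).hasFDerivAt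
  have h1 : HasFDerivAt (fun x' => lagrangianGradient f₀ F (x', y)) _ x :=
    HasFDerivAt.comp (g := lagrangianGradient f₀ F) x hd (hasFDerivAt_prodMk_left x y)
  have h2 : HasFDerivAt (fun y' => lagrangianGradient f₀ F (x, y')) _ y :=
    HasFDerivAt.comp (g := lagrangianGradient f₀ F) y hd (hasFDerivAt_prodMk_right x y)
  have h3 : HasFDerivAt (fun y' => lagrangianGradient f₀ F (x, y')) (adjoint (fderiv ℝ F x)) y :=
    HasFDerivAt.const_add (gradient f₀ x) (adjoint (fderiv ℝ F x)).hasFDerivAt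
  rw [← h2.unique h3, hessLagrangian]
  simp only [gradient_lagrangian (hf₀.differentiable two_ne_zero)
    (hF.differentiable two_ne_zero)]
  rw [h1.fderiv]
  simp [← map_add]

end Lagrangian


/-! ### Derivatives of the data on the Euclidean product. -/

section L2Prod

open ContinuousLinearMap (adjoint)

variable {X Z : Type*} [NormedAddCommGroup X] [InnerProductSpace ℝ X]
  [NormedAddCommGroup Z] [InnerProductSpace ℝ Z]

lemma contDiff_fst_l2Prod : ContDiff ℝ 1 fun e : L2Prod X Z => e.fst :=
  (WithLp.fstL 2 ℝ X Z).contDiff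

lemma contDiff_snd_l2Prod : ContDiff ℝ 1 fun e : L2Prod X Z => e.snd :=
  (WithLp.sndL 2 ℝ X Z).contDiff

lemma fderiv_comp_fst {f₀ : X → ℝ} (hf₀ : Differentiable ℝ f₀) (e w : L2Prod X Z) :
    fderiv ℝ (fun e : L2Prod X Z => f₀ e.fst) e w = fderiv ℝ f₀ e.fst w.fst := by
  have h : HasFDerivAt (fun e : L2Prod X Z => f₀ e.fst)
      ((fderiv ℝ f₀ e.fst).comp (WithLp.fstL 2 ℝ X Z)) e :=
    HasFDerivAt.comp (g := f₀) e (hf₀ e.fst).hasFDerivAt (WithLp.fstL 2 ℝ X Z).hasFDerivAt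
  rw [h.fderiv]
  rfl

lemma fderiv_comp_fst_add_snd {F : X → Z} (hF : Differentiable ℝ F) (e w : L2Prod X Z) :
    fderiv ℝ (fun e : L2Prod X Z => F e.fst + e.snd) e w = fderiv ℝ F e.fst w.fst + w.snd := by
  have h1 : HasFDerivAt (fun e : L2Prod X Z => F e.fst)
      ((fderiv ℝ F e.fst).comp (WithLp.fstL 2 ℝ X Z)) e :=
    HasFDerivAt.comp (g := F) e (hF e.fst).hasFDerivAt (WithLp.fstL 2 ℝ X Z).hasFDerivAt
  have h2 : HasFDerivAt (fun e : L2Prod X Z => F e.fst + e.snd)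
      ((fderiv ℝ F e.fst).comp (WithLp.fstL 2 ℝ X Z) + WithLp.sndL 2 ℝ X Z) e :=
    h1.add (WithLp.sndL 2 ℝ X Z).hasFDerivAt
  rw [h2.fderiv]
  rfl

variable [FiniteDimensional ℝ X] [FiniteDimensional ℝ Z]

lemma gradient_comp_fst {f₀ : X → ℝ} (hf₀ : Differentiable ℝ f₀) (e : L2Prod X Z) :
    gradient (fun e : L2Prod X Z => f₀ e.fst) e = pair (gradient f₀ e.fst) 0 := by
  refine ext_inner_right ℝ fun w => ?_
  rw [inner_gradient, fderiv_comp_fst hf₀, WithLp.prod_inner_apply, ← inner_gradient]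
  simp

/-- The second component shows that this adjoint is injective, so the chain rule in `(x, u)` needs
no qualification condition. -/
lemma adjoint_fderiv_comp_fst_add_snd {F : X → Z} (hF : Differentiable ℝ F) (e : L2Prod X Z)
    (y : Z) :
    adjoint (fderiv ℝ (fun e : L2Prod X Z => F e.fst + e.snd) e) y =
      pair (adjoint (fderiv ℝ F e.fst) y) y := by
  refine ext_inner_right ℝ fun w => ?_
  rw [ContinuousLinearMap.adjoint_inner_left, fderiv_comp_fst_add_snd hF, WithLp.prod_inner_apply]
  simp [inner_add_right, ContinuousLinearMap.adjoint_inner_left]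

end L2Prod

/-! ### Multipliers, and the relation between `dom Y` and `gph M`. -/

section Composite

open ContinuousLinearMap (adjoint)

variable {n m : ℕ} {f₀ : R n → ℝ} {F : R n → R m} {g : R m → EReal}

/-- The multipliers are the subgradients of `g` that satisfy the stationarity equation. -/
theorem mem_mapY_iff (hf₀ : ContDiff ℝ 1 f₀) (hF : ContDiff ℝ 1 F) (hg : IsProper g)
    (hlsc : LowerSemicontinuous g) (hconv : IsConvex g) {q : L2Prod (L2Prod (R n) (R m)) (R n)}
    {y : R m} :
    y ∈ mapY (composite f₀ F g) q ↔ IsSubgradient g (F q.snd + q.fst.snd) y ∧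
      q.fst.fst = lagrangianGradient f₀ F (q.snd, y) := by
  have hφ : ContDiff ℝ 1 fun e : L2Prod (R n) (R m) => f₀ e.fst := hf₀.comp contDiff_fst_l2Prod
  have hΦ : ContDiff ℝ 1 fun e : L2Prod (R n) (R m) => F e.fst + e.snd :=
    (hF.comp contDiff_fst_l2Prod).add contDiff_snd_l2Prod
  have hf₀' := hf₀.differentiable one_ne_zero
  have hF' := hF.differentiable one_ne_zero
  set e : L2Prod (R n) (R m) := pair q.snd q.fst.snd with he
  have hsum : ∀ y, gradient (fun e : L2Prod (R n) (R m) => f₀ e.fst) e +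
      adjoint (fderiv ℝ (fun e : L2Prod (R n) (R m) => F e.fst + e.snd) e) y =
      pair (lagrangianGradient f₀ F (q.snd, y)) y := fun y => by
    rw [gradient_comp_fst hf₀', adjoint_fderiv_comp_fst_add_snd hF', ← WithLp.toLp_add,
      Prod.mk_add_mk, zero_add]
    rfl
  constructor
  · intro hy
    obtain ⟨y', hy', h⟩ := exists_isSubgradient_of_mem_subdiff (e := e) hφ hΦ hg hlsc hconv
      (fun y _ h => by
        rw [adjoint_fderiv_comp_fst_add_snd hF'] at h
        exact congrArg WithLp.snd h) hy
    rw [hsum] at h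
    have h2 : y = y' := congrArg WithLp.snd h
    subst h2
    exact ⟨hy', congrArg WithLp.fst h⟩
  · rintro ⟨hy, h⟩
    have := mem_subdiff_add_comp (e := e) hφ hΦ hg hy
    rw [hsum, ← h] at this
    exact this

theorem mem_mapM_of_mem_mapY (hf₀ : ContDiff ℝ 1 f₀) (hF : ContDiff ℝ 1 F) (hg : IsProper g)
    (hlsc : LowerSemicontinuous g) (hconv : IsConvex g) {q : L2Prod (L2Prod (R n) (R m)) (R n)}
    {y : R m} (hy : y ∈ mapY (composite f₀ F g) q) : q.snd ∈ mapM (composite f₀ F g) q.fst := by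
  obtain ⟨hy, h⟩ := (mem_mapY_iff hf₀ hF hg hlsc hconv).1 hy
  have := mem_subdiff_add_comp (Φ := fun x => F x + q.fst.snd) hf₀ (hF.add contDiff_const) hg hy
  rw [fderiv_add_const] at this
  rw [lagrangianGradient] at h
  rw [← h] at this
  exact this

/-- With `u` frozen, `x ↦ F x + u` need not be a submersion, so the chain rule here does require the
qualification condition. -/
theorem exists_mem_mapY_of_mem_mapM (hf₀ : ContDiff ℝ 1 f₀) (hF : ContDiff ℝ 1 F)
    (hg : IsProper g) (hlsc : LowerSemicontinuous g) (hconv : IsConvex g)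
    {q : L2Prod (L2Prod (R n) (R m)) (R n)}
    (hCQ : ∀ y ∈ convexNormalCone {z | g z < ⊤} (F q.snd + q.fst.snd),
      adjoint (fderiv ℝ F q.snd) y = 0 → y = 0)
    (hx : q.snd ∈ mapM (composite f₀ F g) q.fst) : q ∈ dom (mapY (composite f₀ F g)) := by
  obtain ⟨y, hy, h⟩ := exists_isSubgradient_of_mem_subdiff (Φ := fun x => F x + q.fst.snd) hf₀
    (hF.add contDiff_const) hg hlsc hconv (by rwa [fderiv_add_const]) hx
  rw [fderiv_add_const] at h
  exact ⟨y, (mem_mapY_iff hf₀ hF hg hlsc hconv).2 ⟨hy, h⟩⟩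

lemma continuous_data (hF : Continuous F) :
    Continuous fun q : L2Prod (L2Prod (R n) (R m)) (R n) => F q.snd + q.fst.snd :=
  (hF.comp (WithLp.continuous_snd 2 _ _)).add
    ((WithLp.continuous_snd 2 _ _).comp (WithLp.continuous_fst 2 _ _))

lemma continuous_snd_l2Prod :
    Continuous fun q : L2Prod (L2Prod (R n) (R m)) (R n) => q.snd :=
  WithLp.continuous_snd 2 _ _

lemma continuous_fst_fst :
    Continuous fun q : L2Prod (L2Prod (R n) (R m)) (R n) => q.fst.fst :=
  (WithLp.continuous_fst 2 _ _).comp (WithLp.continuous_fst 2 _ _)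

lemma continuous_fst_snd :
    Continuous fun q : L2Prod (L2Prod (R n) (R m)) (R n) => q.fst.snd :=
  (WithLp.continuous_snd 2 _ _).comp (WithLp.continuous_fst 2 _ _)

/-- The basic qualification condition is robust, so that near the reference point the graph of `M`
is contained in the domain of `Y`. -/
theorem eventually_mem_dom_mapY (hf₀ : ContDiff ℝ 1 f₀) (hF : ContDiff ℝ 1 F)
    (hg : IsProper g) (hlsc : LowerSemicontinuous g) (hconv : IsConvex g)
    {q₀ : L2Prod (L2Prod (R n) (R m)) (R n)}
    (hCQ : ∀ y ∈ convexNormalCone {z | g z < ⊤} (F q₀.snd + q₀.fst.snd),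
      adjoint (fderiv ℝ F q₀.snd) y = 0 → y = 0) :
    ∀ᶠ q in 𝓝 q₀, q.snd ∈ mapM (composite f₀ F g) q.fst → q ∈ dom (mapY (composite f₀ F g)) := by
  by_contra hcon
  obtain ⟨q, hq, hbad⟩ := exists_seq_forall_of_frequently (not_eventually.1 hcon)
  -- Where a stationary point has no multiplier, the qualification condition must fail; the failing
  -- normal can be scaled to unit length, and a limit of these violates the condition at `q₀`.
  have hex : ∀ k, ∃ y ∈ convexNormalCone {z | g z < ⊤} (F (q k).snd + (q k).fst.snd),
      adjoint (fderiv ℝ F (q k).snd) y = 0 ∧ ‖y‖ = 1 := fun k => by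
    by_contra hno
    push Not at hno
    refine hbad k fun hx => exists_mem_mapY_of_mem_mapM hf₀ hF hg hlsc hconv
      (fun y hy h0 => ?_) hx
    by_contra hy0
    refine hno (‖y‖⁻¹ • y) (smul_mem_convexNormalCone (by positivity) hy) (by simp [h0]) ?_
    rw [norm_smul, norm_inv, norm_norm, inv_mul_cancel₀ (norm_ne_zero_iff.2 hy0)]
  choose y hyN hy0 hy1 using hex
  obtain ⟨y₀, -, φ, hφ, hlim⟩ := tendsto_subseq_of_bounded
    (Metric.isBounded_closedBall (x := (0 : R m)) (r := 1))
    (fun k => mem_closedBall_zero_iff.2 (hy1 k).le)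
  have hqφ := hq.comp hφ.tendsto_atTop
  have h1 : ‖y₀‖ = 1 :=
    tendsto_nhds_unique hlim.norm (tendsto_const_nhds.congr fun k => (hy1 _).symm)
  have h2 := hCQ y₀ (mem_convexNormalCone_of_tendsto
    (((continuous_data hF.continuous).tendsto q₀).comp hqφ) hlim fun k => hyN _) ?_
  · simp [h2] at h1
  · refine tendsto_nhds_unique (tendsto_adjoint_apply
      (((hF.continuous_fderiv one_ne_zero).comp continuous_snd_l2Prod).tendsto q₀ |>.comp hqφ)
      hlim) (tendsto_const_nhds.congr fun k => (hy0 _).symm)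

end Composite


/-! ### Tangents to `gph ∂g` versus tangents to `dom Y`. -/

section Correspondence

open ContinuousLinearMap (adjoint)

variable {n m : ℕ} {f₀ : R n → ℝ} {F : R n → R m} {g : R m → EReal}

/-- Tangents to the graph of `∂g` yield tangents to the domain of `Y`. -/
theorem mem_tangentCone_dom_mapY (hf₀ : ContDiff ℝ 2 f₀) (hF : ContDiff ℝ 2 F) (hg : IsProper g)
    (hlsc : LowerSemicontinuous g) (hconv : IsConvex g) {x : R n} {u y dz dy : R m}
    (h : (dz, dy) ∈ tangentCone (gph (subdiff g)) (F x + u, y)) (dx : R n) :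
    pair (pair (fderiv ℝ (lagrangianGradient f₀ F) (x, y) (dx, dy)) (dz - fderiv ℝ F x dx)) dx ∈
      tangentCone (dom (mapY (composite f₀ F g)))
        (pair (pair (lagrangianGradient f₀ F (x, y)) u) x) := by
  obtain ⟨dk, tk, hdk, ht, ht0, hC⟩ := h
  have hdk1 : Tendsto (fun k => (dk k).1) atTop (𝓝 dz) := (continuous_fst.tendsto _).comp hdk
  have hdk2 : Tendsto (fun k => (dk k).2) atTop (𝓝 dy) := (continuous_snd.tendsto _).comp hdk
  have hL := tendsto_difference_quotient
    ((contDiff_lagrangianGradient hf₀ hF).differentiable one_ne_zero (x, y)).hasFDerivAt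
    ((tendsto_const_nhds (x := dx)).prodMk_nhds hdk2) ht ht0
  have hFd := tendsto_difference_quotient (hF.differentiable two_ne_zero x).hasFDerivAt
    (tendsto_const_nhds (x := dx)) ht ht0
  -- Move `x` along the constant direction `dx` and `(z, y)` along the given tangent sequence. Then
  -- `v` and `u` are forced, and their difference quotients converge.
  refine ⟨fun k => pair (pair ((tk k)⁻¹ • (lagrangianGradient f₀ F ((x, y) + tk k • (dx, (dk k).2))
      - lagrangianGradient f₀ F (x, y))) ((dk k).1 - (tk k)⁻¹ • (F (x + tk k • dx) - F x))) dx,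
    tk, ?_, ht, ht0, fun k => ⟨y + tk k • (dk k).2, ?_⟩⟩
  · exact ((WithLp.prod_continuous_toLp 2 _ _).tendsto _).comp
      ((((WithLp.prod_continuous_toLp 2 _ _).tendsto _).comp
        (hL.prodMk_nhds (hdk1.sub hFd))).prodMk_nhds tendsto_const_nhds)
  · rw [mem_mapY_iff (hf₀.of_le one_le_two) (hF.of_le one_le_two) hg hlsc hconv]
    have hk := (mem_subdiff_iff_isSubgradient hg hlsc hconv).1 (hC k)
    simp only [WithLp.add_fst, WithLp.add_snd, WithLp.smul_fst, WithLp.smul_snd, pair_fst,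
      pair_snd, smul_sub, smul_inv_smul₀ (ht k).ne']
    refine ⟨?_, ?_⟩
    · convert hk using 1
      · simp only [Prod.fst_add, Prod.smul_fst]
        abel
      · rfl
    · simp

/-- The fuzzy inner calmness condition for `Y` provides a multiplier and a tangent to the graph of
`∂g` with a norm bound. -/
theorem exists_tangent_of_fuzzyInnerCalmConst (hf₀ : ContDiff ℝ 2 f₀) (hF : ContDiff ℝ 2 F)
    (hg : IsProper g) (hlsc : LowerSemicontinuous g) (hconv : IsConvex g)
    {q d : L2Prod (L2Prod (R n) (R m)) (R n)} {κ : ℝ}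
    (h : FuzzyInnerCalmConst (mapY (composite f₀ F g)) q d κ) :
    ∃ y e : R m, y ∈ mapY (composite f₀ F g) q ∧ ‖e‖ ≤ κ * ‖d‖ ∧
      (fderiv ℝ F q.snd d.snd + d.fst.snd, e) ∈
        tangentCone (gph (subdiff g)) (F q.snd + q.fst.snd, y) ∧
      d.fst.fst = fderiv ℝ (lagrangianGradient f₀ F) (q.snd, y) (d.snd, e) := by
  obtain ⟨hκ, y, dk, tk, yk, hdk, ht, ht0, hyk, hk⟩ := h
  have hf1 := hf₀.of_le one_le_two
  have hF1 := hF.of_le one_le_two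
  have hsub := fun k => (mem_mapY_iff hf1 hF1 hg hlsc hconv).1 (hk k).2.1
  have hqk := tendsto_add_smul (x := q) hdk ht0
  have hLc := (contDiff_lagrangianGradient hf₀ hF).continuous
  have hy : y ∈ mapY (composite f₀ F g) q := by
    rw [mem_mapY_iff hf1 hF1 hg hlsc hconv]
    refine ⟨isSubgradient_of_tendsto hlsc
      (((continuous_data hF.continuous).tendsto q).comp hqk) hyk fun k => (hsub k).1, ?_⟩
    exact tendsto_nhds_unique (((continuous_fst_fst.tendsto q).comp hqk).congr
      fun k => (hsub k).2) ((hLc.tendsto (q.snd, y)).comp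
        (((continuous_snd_l2Prod.tendsto q).comp hqk).prodMk_nhds hyk))
  have hyL := ((mem_mapY_iff hf1 hF1 hg hlsc hconv).1 hy).2
  -- Inner calmness* bounds these difference quotients of the multipliers, so a subsequence
  -- converges to the direction `e`.
  set ek : ℕ → R m := fun k => (tk k)⁻¹ • (yk k - y) with hek
  have hek_le : ∀ k, ‖ek k‖ ≤ κ * ‖dk k‖ := fun k => by
    simp only [hek, norm_smul, norm_inv, Real.norm_of_nonneg (ht k).le]
    rw [inv_mul_le_iff₀ (ht k)]
    linarith [(hk k).2.2]
  have hyk' : ∀ k, yk k = y + tk k • ek k := fun k => by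
    simp [hek, smul_inv_smul₀ (ht k).ne']
  have hlimle : Tendsto (fun k => κ * ‖dk k‖) atTop (𝓝 (κ * ‖d‖)) := hdk.norm.const_mul κ
  obtain ⟨e, -, φ, hφ, hlim⟩ := tendsto_subseq_of_frequently_bounded
    (Metric.isBounded_closedBall (x := (0 : R m)) (r := κ * ‖d‖ + 1)) (x := ek)
    (Eventually.frequently (by
      filter_upwards [hlimle.eventually_lt_const (lt_add_one _)] with k hk
      exact mem_closedBall_zero_iff.2 ((hek_le k).trans hk.le)))
  have hdφ := hdk.comp hφ.tendsto_atTop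
  have htφ := ht0.comp hφ.tendsto_atTop
  have hd1 : Tendsto (fun k => (dk (φ k)).snd) atTop (𝓝 d.snd) :=
    (continuous_snd_l2Prod.tendsto d).comp hdφ
  have hd2 : Tendsto (fun k => (dk (φ k)).fst.snd) atTop (𝓝 d.fst.snd) :=
    (continuous_fst_snd.tendsto d).comp hdφ
  have hd3 : Tendsto (fun k => (dk (φ k)).fst.fst) atTop (𝓝 d.fst.fst) :=
    (continuous_fst_fst.tendsto d).comp hdφ
  have hL := tendsto_difference_quotient
    ((contDiff_lagrangianGradient hf₀ hF).differentiable one_ne_zero (q.snd, y)).hasFDerivAt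
    (hd1.prodMk_nhds hlim) (fun k => ht (φ k)) htφ
  have hFd := tendsto_difference_quotient (hF.differentiable two_ne_zero q.snd).hasFDerivAt
    hd1 (fun k => ht (φ k)) htφ
  refine ⟨y, e, hy, le_of_tendsto_of_tendsto hlim.norm (hlimle.comp hφ.tendsto_atTop)
    (Eventually.of_forall fun k => hek_le _), ⟨fun k => ((tk (φ k))⁻¹ •
      (F (q.snd + tk (φ k) • (dk (φ k)).snd) - F q.snd) + (dk (φ k)).fst.snd, ek (φ k)),
    fun k => tk (φ k), (hFd.add hd2).prodMk_nhds hlim, fun k => ht _, htφ, fun k => ?_⟩, ?_⟩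
  · refine (mem_subdiff_iff_isSubgradient hg hlsc hconv).2 ?_
    have h1 := (hsub (φ k)).1
    rw [hyk'] at h1
    convert h1 using 1
    · simp only [Prod.fst_add, Prod.smul_fst, smul_add, smul_inv_smul₀ (ht (φ k)).ne',
        WithLp.add_fst, WithLp.add_snd, WithLp.smul_fst, WithLp.smul_snd]
      abel
    · rfl
  · refine tendsto_nhds_unique (hd3.congr fun k => ?_) hL
    have h1 := (hsub (φ k)).2
    rw [hyk'] at h1
    simp only [WithLp.add_fst, WithLp.add_snd, WithLp.smul_fst, WithLp.smul_snd] at h1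
    simp only [Function.comp_apply, Prod.smul_mk, Prod.mk_add_mk]
    rw [← h1, ← hyL, add_sub_cancel_left, inv_smul_smul₀ (ht (φ k)).ne']

theorem stronglyNoncritical_iff (hf₀ : ContDiff ℝ 2 f₀) (hF : ContDiff ℝ 2 F) {x : R n}
    {y : R m} : StronglyNoncritical f₀ F g x y ↔ ∀ (dx : R n) (dy : R m),
      fderiv ℝ (lagrangianGradient f₀ F) (x, y) (dx, dy) = 0 →
      (fderiv ℝ F x dx, dy) ∈ limitingTangentCone (gph (subdiff g)) (F x, y) → dx = 0 := by
  simp only [StronglyNoncritical, hessLagrangian_add hf₀ hF]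
  rfl

/-- Bounded sequences of multipliers under the basic qualification condition. -/
theorem exists_subseq_multipliers (hf₀ : ContDiff ℝ 2 f₀) (hF : ContDiff ℝ 2 F)
    (hg : IsProper g) (hlsc : LowerSemicontinuous g) (hconv : IsConvex g)
    {q : ℕ → L2Prod (L2Prod (R n) (R m)) (R n)} {q₀ : L2Prod (L2Prod (R n) (R m)) (R n)}
    (hfin : g (F q₀.snd + q₀.fst.snd) ≠ ⊤)
    (hCQ : ∀ y ∈ convexNormalCone {z | g z < ⊤} (F q₀.snd + q₀.fst.snd),
      adjoint (fderiv ℝ F q₀.snd) y = 0 → y = 0)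
    (hq : Tendsto q atTop (𝓝 q₀)) {y : ℕ → R m}
    (hy : ∀ k, y k ∈ mapY (composite f₀ F g) (q k)) :
    ∃ (φ : ℕ → ℕ) (y₀ : R m), StrictMono φ ∧ Tendsto (y ∘ φ) atTop (𝓝 y₀) ∧
      y₀ ∈ mapY (composite f₀ F g) q₀ := by
  have hf1 := hf₀.of_le one_le_two
  have hF1 := hF.of_le one_le_two
  have hsub := fun k => (mem_mapY_iff hf1 hF1 hg hlsc hconv).1 (hy k)
  have hLc := (contDiff_lagrangianGradient hf₀ hF).continuous
  have hx := (continuous_snd_l2Prod.tendsto q₀).comp hq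
  have hv := (continuous_fst_fst.tendsto q₀).comp hq
  have hz := ((continuous_data hF.continuous).tendsto q₀).comp hq
  have hA := ((hF1.continuous_fderiv one_ne_zero).tendsto q₀.snd).comp hx
  have hgr : Tendsto (fun k => gradient f₀ (q k).snd) atTop
      (𝓝 (lagrangianGradient f₀ F (q₀.snd, 0))) :=
    ((hLc.tendsto (q₀.snd, 0)).comp (hx.prodMk_nhds tendsto_const_nhds)).congr fun k => by
      simp [lagrangianGradient]
  have hη : Tendsto (fun k => adjoint (fderiv ℝ F (q k).snd) (y k)) atTop
      (𝓝 (q₀.fst.fst - lagrangianGradient f₀ F (q₀.snd, 0))) :=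
    (hv.sub hgr).congr fun k => by
      have := (hsub k).2
      rw [lagrangianGradient] at this
      simp only [Function.comp_apply, this, add_sub_cancel_left]
  rcases exists_subseq_or_kernel hA hη with ⟨φ, y₀, hφ, hlim⟩ | ⟨φ, y₀, hφ, h1, h0, hinv, hlim⟩
  · refine ⟨φ, y₀, hφ, hlim, (mem_mapY_iff hf1 hF1 hg hlsc hconv).2
      ⟨isSubgradient_of_tendsto hlsc (hz.comp hφ.tendsto_atTop) hlim fun k => (hsub _).1, ?_⟩⟩
    exact tendsto_nhds_unique ((hv.comp hφ.tendsto_atTop).congr fun k => (hsub _).2)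
      ((hLc.tendsto (q₀.snd, y₀)).comp ((hx.comp hφ.tendsto_atTop).prodMk_nhds hlim))
  · refine absurd (hCQ y₀ (fun z' hz' => ?_) h0) (norm_ne_zero_iff.1 (by simp [h1]))
    obtain ⟨a, ha⟩ := isProper_exists_coe hg (ne_of_lt hz')
    obtain ⟨b, hb⟩ := isProper_exists_coe hg hfin
    -- Lower semicontinuity bounds `g` from below along the sequence. Dividing the subgradient
    -- inequality by `‖y (φ k)‖ → ∞` then makes the limit `y₀` normal to the effective domain,
    -- against the qualification condition.
    have hlow : ∀ᶠ k in atTop, ((b - 1 : ℝ) : EReal) < g (F (q k).snd + (q k).fst.snd) :=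
      hz.eventually (hlsc _ _ (lt_of_lt_of_eq (EReal.coe_lt_coe_iff.2 (sub_one_lt b)) hb.symm))
    have hzφ := hz.comp hφ.tendsto_atTop
    have hl := hlim.inner (𝕜 := ℝ) ((tendsto_const_nhds (x := z')).sub hzφ)
    have hr : Tendsto (fun k => ‖y (φ k)‖⁻¹ * (a - (b - 1))) atTop (𝓝 0) := by
      simpa using hinv.mul_const (a - (b - 1))
    refine le_of_tendsto_of_tendsto hl hr ?_
    filter_upwards [hφ.tendsto_atTop.eventually hlow] with k hk
    have h2 := hk.trans_le ((hsub (φ k)).1 z' a ha.le)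
    rw [EReal.coe_lt_coe_iff] at h2
    rw [real_inner_smul_left]
    refine mul_le_mul_of_nonneg_left ?_ (by positivity)
    simp only [Function.comp_apply]
    linarith

end Correspondence

/-! ### The two implications. -/

section Equivalence

open ContinuousLinearMap (adjoint)

variable {n m : ℕ} {f₀ : R n → ℝ} {F : R n → R m} {g : R m → EReal} {xbar : R n}

/-- `dom Y ⊆ gph M` holds unconditionally, so tangents to `dom Y` inherit the calmness estimate. -/
theorem norm_le_of_mem_tangentCone_dom_mapY (hf₀ : ContDiff ℝ 2 f₀) (hF : ContDiff ℝ 2 F)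
    (hg : IsProper g) (hlsc : LowerSemicontinuous g) (hconv : IsConvex g) {κ : ℝ}
    {q d : L2Prod (L2Prod (R n) (R m)) (R n)}
    (hcalm : IsolatedlyCalmAt (mapM (composite f₀ F g)) q.fst q.snd κ)
    (hd : d ∈ tangentCone (dom (mapY (composite f₀ F g))) q) : ‖d.snd‖ ≤ κ * ‖d.fst‖ :=
  norm_snd_le_of_mem_tangentCone hcalm
    (tangentCone_mono_of_eventually hd (Eventually.of_forall fun _ ⟨_, hy⟩ =>
      mem_mapM_of_mem_mapY (hf₀.of_le one_le_two) (hF.of_le one_le_two) hg hlsc hconv hy))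

/-- Points of `gph ∂g` near `(F xbar, y)` become points of `dom Y` with `x` kept at `xbar`, the
mismatch being absorbed by `v` and `u`. The calmness constant is uniform at these points, so the
estimate survives the limit. -/
theorem stronglyNoncritical_of_isolatedlyCalmAround (hf₀ : ContDiff ℝ 2 f₀)
    (hF : ContDiff ℝ 2 F) (hg : IsProper g) (hlsc : LowerSemicontinuous g) (hconv : IsConvex g)
    (hcalm : IsolatedlyCalmAround (mapM (composite f₀ F g)) (pair 0 0) xbar) {y : R m}
    (hy : y ∈ mapY (composite f₀ F g) (pair (pair 0 0) xbar)) :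
    StronglyNoncritical f₀ F g xbar y := by
  rw [stronglyNoncritical_iff hf₀ hF]
  rintro dx dy hdx ⟨zk, dk, hzk, hdk, hk⟩
  obtain ⟨κ, -, W, hW, hcalm⟩ := hcalm
  have hf1 := hf₀.of_le one_le_two
  have hF1 := hF.of_le one_le_two
  have hLG := contDiff_lagrangianGradient hf₀ hF
  have hzk1 : Tendsto (fun k => (zk k).1) atTop (𝓝 (F xbar)) := (continuous_fst.tendsto _).comp hzk
  have hzk2 : Tendsto (fun k => (zk k).2) atTop (𝓝 y) := (continuous_snd.tendsto _).comp hzk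
  have hdk1 : Tendsto (fun k => (dk k).1) atTop (𝓝 (fderiv ℝ F xbar dx)) :=
    (continuous_fst.tendsto _).comp hdk
  have hdk2 : Tendsto (fun k => (dk k).2) atTop (𝓝 dy) := (continuous_snd.tendsto _).comp hdk
  have hxy : Tendsto (fun k => (xbar, (zk k).2)) atTop (𝓝 (xbar, y)) :=
    tendsto_const_nhds.prodMk_nhds hzk2
  have hpair : ∀ (a : ℕ → R n) (b : ℕ → R m) (a₀ : R n) (b₀ : R m), Tendsto a atTop (𝓝 a₀) →
      Tendsto b atTop (𝓝 b₀) → Tendsto (fun k => pair (a k) (b k)) atTop (𝓝 (pair a₀ b₀)) :=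
    fun a b a₀ b₀ ha hb =>
      ((WithLp.prod_continuous_toLp 2 _ _).tendsto (a₀, b₀)).comp (ha.prodMk_nhds hb)
  have hv := (hLG.continuous.tendsto (xbar, y)).comp hxy
  have hy0 : (0 : R n) = lagrangianGradient f₀ F (xbar, y) :=
    ((mem_mapY_iff hf1 hF1 hg hlsc hconv).1 hy).2
  rw [← hy0] at hv
  have hu : Tendsto (fun k => (zk k).1 - F xbar) atTop (𝓝 0) := by
    simpa using hzk1.sub_const (F xbar)
  have hs := hpair _ _ _ _ hv hu
  have hdv : Tendsto (fun k => fderiv ℝ (lagrangianGradient f₀ F) (xbar, (zk k).2) (dx, (dk k).2))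
      atTop (𝓝 0) := by
    have hD := ((hLG.continuous_fderiv one_ne_zero).tendsto (xbar, y)).comp hxy
    have hw : Tendsto (fun k => (dx, (dk k).2)) atTop (𝓝 (dx, dy)) :=
      tendsto_const_nhds.prodMk_nhds hdk2
    have := tendsto_clm_apply hD hw
    rwa [hdx] at this
  have hdu : Tendsto (fun k => (dk k).1 - fderiv ℝ F xbar dx) atTop (𝓝 0) := by
    simpa using hdk1.sub_const (fderiv ℝ F xbar dx)
  have hle : ‖dx‖ ≤ κ * ‖(pair 0 0 : L2Prod (R n) (R m))‖ := by
    refine ge_of_tendsto ((hpair _ _ _ _ hdv hdu).norm.const_mul κ) ?_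
    filter_upwards [(hs.prodMk_nhds tendsto_const_nhds).eventually hW] with k hkW
    have hcone : dk k ∈ tangentCone (gph (subdiff g))
        (F xbar + ((zk k).1 - F xbar), (zk k).2) := by
      rw [add_sub_cancel]; exact (hk k).2
    have ht := mem_tangentCone_dom_mapY hf₀ hF hg hlsc hconv hcone dx
    set v := lagrangianGradient f₀ F (xbar, (zk k).2)
    set q : L2Prod (L2Prod (R n) (R m)) (R n) := pair (pair v ((zk k).1 - F xbar)) xbar with hq
    have hmem : (zk k).2 ∈ mapY (composite f₀ F g) q := by
      refine (mem_mapY_iff hf1 hF1 hg hlsc hconv).2 ⟨?_, rfl⟩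
      simp only [hq, pair_fst, pair_snd, add_sub_cancel]
      exact (mem_subdiff_iff_isSubgradient hg hlsc hconv).1 (hk k).1
    have hc := hcalm (q.fst, q.snd) ⟨hkW, mem_mapM_of_mem_mapY hf1 hF1 hg hlsc hconv hmem⟩
    have hfin := norm_le_of_mem_tangentCone_dom_mapY hf₀ hF hg hlsc hconv hc ht
    simp only [pair_fst, pair_snd] at hfin
    exact hfin
  have h0 : (pair 0 0 : L2Prod (R n) (R m)) = 0 := rfl
  rw [h0, norm_zero, mul_zero] at hle
  exact norm_le_zero_iff.1 hle

/-- The condition `κ‖(dv,du)‖ < ‖dx‖` is open and holds at `(0,0,dx)`. By calmness no such direction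
is tangent to `dom Y` nearby, so inner calmness* is vacuous with modulus `0`. -/
theorem locallyUniformlyFuzzyInnerCalm_of_isolatedlyCalmAround (hf₀ : ContDiff ℝ 2 f₀)
    (hF : ContDiff ℝ 2 F) (hg : IsProper g) (hlsc : LowerSemicontinuous g) (hconv : IsConvex g)
    (hcalm : IsolatedlyCalmAround (mapM (composite f₀ F g)) (pair 0 0) xbar) {dx : R n}
    (hdx : dx ≠ 0) :
    LocallyUniformlyFuzzyInnerCalm (mapY (composite f₀ F g)) (pair (pair 0 0) xbar)
      (pair (pair 0 0) dx) := by
  obtain ⟨κ, hκ, W, hW, hcalm⟩ := hcalm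
  have hf1 := hf₀.of_le one_le_two
  have hF1 := hF.of_le one_le_two
  have hc1 : Continuous fun q : L2Prod (L2Prod (R n) (R m)) (R n) => q.fst :=
    WithLp.continuous_fst 2 _ _
  have hc2 := continuous_snd_l2Prod (n := n) (m := m)
  refine ⟨(fun q => (q.fst, q.snd)) ⁻¹' W, (hc1.prodMk hc2).continuousAt.preimage_mem_nhds hW,
    {d | κ * ‖d.fst‖ < ‖d.snd‖},
    (isOpen_lt (hc1.norm.const_mul κ) hc2.norm).mem_nhds ?_, κ, hκ, ?_⟩
  · have h0 : (pair 0 0 : L2Prod (R n) (R m)) = 0 := rfl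
    simpa [h0] using hdx
  · rintro q ⟨hqW, y, hy⟩ d hd
    exact fuzzyInnerCalm_of_notMem hκ.le fun ht => (show κ * ‖d.fst‖ < ‖d.snd‖ from hd).not_ge <| norm_le_of_mem_tangentCone_dom_mapY hf₀ hF hg hlsc hconv
      (hcalm _ ⟨hqW, mem_mapM_of_mem_mapY hf1 hF1 hg hlsc hconv hy⟩) ht

/-- A limiting argument: bounded tangents at nearby multipliers yield a multiplier at the
reference point that is not strongly noncritical. -/
theorem exists_critical_of_tendsto (hf₀ : ContDiff ℝ 2 f₀) (hF : ContDiff ℝ 2 F)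
    (hg : IsProper g) (hlsc : LowerSemicontinuous g) (hconv : IsConvex g)
    {q d : ℕ → L2Prod (L2Prod (R n) (R m)) (R n)} {q₀ d₀ : L2Prod (L2Prod (R n) (R m)) (R n)}
    (hfin : g (F q₀.snd + q₀.fst.snd) ≠ ⊤)
    (hCQ : ∀ y ∈ convexNormalCone {z | g z < ⊤} (F q₀.snd + q₀.fst.snd),
      adjoint (fderiv ℝ F q₀.snd) y = 0 → y = 0)
    (hq : Tendsto q atTop (𝓝 q₀)) (hd : Tendsto d atTop (𝓝 d₀)) {K : ℝ}
    (h : ∀ k, ∃ y e : R m, y ∈ mapY (composite f₀ F g) (q k) ∧ ‖e‖ ≤ K ∧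
      (fderiv ℝ F (q k).snd (d k).snd + (d k).fst.snd, e) ∈
        tangentCone (gph (subdiff g)) (F (q k).snd + (q k).fst.snd, y) ∧
      (d k).fst.fst = fderiv ℝ (lagrangianGradient f₀ F) ((q k).snd, y) ((d k).snd, e)) :
    ∃ y e : R m, y ∈ mapY (composite f₀ F g) q₀ ∧
      (fderiv ℝ F q₀.snd d₀.snd + d₀.fst.snd, e) ∈
        limitingTangentCone (gph (subdiff g)) (F q₀.snd + q₀.fst.snd, y) ∧
      d₀.fst.fst = fderiv ℝ (lagrangianGradient f₀ F) (q₀.snd, y) (d₀.snd, e) := by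
  choose y e hy he ht hv using h
  obtain ⟨φ, y₀, hφ, hlim, hy₀⟩ := exists_subseq_multipliers hf₀ hF hg hlsc hconv hfin hCQ hq hy
  obtain ⟨e₀, -, ψ, hψ, hlime⟩ := tendsto_subseq_of_bounded
    (Metric.isBounded_closedBall (x := (0 : R m)) (r := K))
    (fun k => mem_closedBall_zero_iff.2 (he (φ k)))
  have hθ : Tendsto (fun k => φ (ψ k)) atTop atTop := hφ.tendsto_atTop.comp hψ.tendsto_atTop
  have hyθ := hlim.comp hψ.tendsto_atTop
  have hqθ := hq.comp hθ
  have hdθ := hd.comp hθ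
  have hx := (continuous_snd_l2Prod.tendsto q₀).comp hqθ
  have hz := ((continuous_data hF.continuous).tendsto q₀).comp hqθ
  have hdx := (continuous_snd_l2Prod.tendsto d₀).comp hdθ
  have hdu := (continuous_fst_snd.tendsto d₀).comp hdθ
  have hdv := (continuous_fst_fst.tendsto d₀).comp hdθ
  have hLG := contDiff_lagrangianGradient hf₀ hF
  have hdF := tendsto_clm_apply
    (((hF.continuous_fderiv two_ne_zero).tendsto q₀.snd).comp hx) hdx
  have hxy := hx.prodMk_nhds hyθ
  have hde := hdx.prodMk_nhds hlime
  have hdL := tendsto_clm_apply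
    (((hLG.continuous_fderiv one_ne_zero).tendsto (q₀.snd, y₀)).comp hxy) hde
  -- The base points move with `k`, so the limit lies only in the limiting tangent cone; hence the
  -- strong form of noncriticality.
  refine ⟨y₀, e₀, hy₀, ⟨fun k => (F (q (φ (ψ k))).snd + (q (φ (ψ k))).fst.snd, y (φ (ψ k))),
    fun k => (fderiv ℝ F (q (φ (ψ k))).snd (d (φ (ψ k))).snd + (d (φ (ψ k))).fst.snd,
      e (φ (ψ k))), hz.prodMk_nhds hyθ, ?_, fun k => ⟨?_, ht _⟩⟩, ?_⟩
  · exact (hdF.add hdu).prodMk_nhds hlime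
  · exact (mem_subdiff_iff_isSubgradient hg hlsc hconv).2 ((mem_mapY_iff (hf₀.of_le one_le_two)
      (hF.of_le one_le_two) hg hlsc hconv).1 (hy _)).1
  · exact tendsto_nhds_unique (hdv.congr fun k => hv _) hdL

theorem isolatedlyCalmAround_of_stronglyNoncritical (hf₀ : ContDiff ℝ 2 f₀)
    (hF : ContDiff ℝ 2 F) (hg : IsProper g) (hlsc : LowerSemicontinuous g) (hconv : IsConvex g)
    (hfin : g (F xbar) ≠ ⊤) (hCQ : BasicCQ F g xbar)
    (hnc : ∀ y ∈ mapY (composite f₀ F g) (pair (pair 0 0) xbar),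
      StronglyNoncritical f₀ F g xbar y)
    (hic : ∀ dx : R n, dx ≠ 0 → LocallyUniformlyFuzzyInnerCalm (mapY (composite f₀ F g))
      (pair (pair 0 0) xbar) (pair (pair 0 0) dx)) :
    IsolatedlyCalmAround (mapM (composite f₀ F g)) (pair 0 0) xbar := by
  by_contra hcon
  set q₀ : L2Prod (L2Prod (R n) (R m)) (R n) := pair (pair 0 0) xbar with hq₀
  have hf1 := hf₀.of_le one_le_two
  have hF1 := hF.of_le one_le_two
  have hz₀ : F q₀.snd + q₀.fst.snd = F xbar := by simp [hq₀]
  have hfin' : g (F q₀.snd + q₀.fst.snd) ≠ ⊤ := by rwa [hz₀]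
  have hCQ' : ∀ y ∈ convexNormalCone {z | g z < ⊤} (F q₀.snd + q₀.fst.snd),
      adjoint (fderiv ℝ F q₀.snd) y = 0 → y = 0 := fun y hy h0 => by
    rw [hz₀] at hy
    exact hCQ y h0 (mem_singularSubdiff_of_mem_convexNormalCone hg hfin hy)
  -- Calmness fails with constant `k + 1` within distance `1 / (k + 1)`. The resulting tangents
  -- satisfy `(k + 1)‖a k‖ ≤ 1` and `‖b k‖ = 1`, so only the `x`-part survives in the limit.
  have hex : ∀ k : ℕ, ∃ p ∈ Metric.ball ((pair 0 0 : L2Prod (R n) (R m)), xbar) (1 / (k + 1)) ∩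
      gph (mapM (composite f₀ F g)),
      ¬ IsolatedlyCalmAt (mapM (composite f₀ F g)) p.1 p.2 (k + 1) := fun k => by
    by_contra hno
    push Not at hno
    exact hcon ⟨k + 1, by positivity, _, Metric.ball_mem_nhds _ Nat.one_div_pos_of_nat, hno⟩
  choose p hp hbad using hex
  choose a b hab hb1 htan using fun k : ℕ =>
    exists_tangent_of_not_isolatedlyCalmAt (by positivity : (0 : ℝ) < (k : ℝ) + 1) (hbad k)
  have hz := tendsto_one_div_add_atTop_nhds_zero_nat (𝕜 := ℝ)
  have hplim : Tendsto p atTop (𝓝 (pair 0 0, xbar)) := by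
    rw [tendsto_iff_dist_tendsto_zero]
    exact squeeze_zero (fun _ => dist_nonneg) (fun k => (Metric.mem_ball.1 (hp k).1).le) hz
  have halim : Tendsto a atTop (𝓝 0) := by
    refine squeeze_zero_norm (fun k => ?_) hz
    rw [le_div_iff₀ (by positivity), mul_comm]
    exact hab k
  obtain ⟨b₀, -, φ, hφ, hblim⟩ := tendsto_subseq_of_bounded
    (Metric.isBounded_closedBall (x := (0 : R n)) (r := 1))
    (fun k => mem_closedBall_zero_iff.2 (hb1 k).le)
  have hb₀ : ‖b₀‖ = 1 :=
    tendsto_nhds_unique hblim.norm (tendsto_const_nhds.congr fun k => (hb1 _).symm)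
  have hb₀0 : b₀ ≠ 0 := norm_ne_zero_iff.1 (by simp [hb₀])
  set q : ℕ → L2Prod (L2Prod (R n) (R m)) (R n) := fun k => pair (p (φ k)).1 (p (φ k)).2 with hqdef
  set d : ℕ → L2Prod (L2Prod (R n) (R m)) (R n) := fun k => pair (a (φ k)) (b (φ k)) with hddef
  have hq : Tendsto q atTop (𝓝 q₀) :=
    ((WithLp.prod_continuous_toLp 2 _ _).tendsto (pair 0 0, xbar)).comp
      (hplim.comp hφ.tendsto_atTop)
  have hd : Tendsto d atTop (𝓝 (pair (pair 0 0) b₀)) :=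
    ((WithLp.prod_continuous_toLp 2 _ _).tendsto (pair 0 0, b₀)).comp
      ((halim.comp hφ.tendsto_atTop).prodMk_nhds hblim)
  obtain ⟨U, hU, N, hN, κ, hκ, hUN⟩ := hic b₀ hb₀0
  have hev := eventually_mem_dom_mapY hf1 hF1 hg hlsc hconv hCQ'
  -- The first `+ 1` is the slack for the infimum in the modulus, the second covers the norms of `d
  -- k` near their limit.
  set K : ℝ := (κ + 1) * (‖(pair (pair 0 0) b₀ : L2Prod (L2Prod (R n) (R m)) (R n))‖ + 1)
  have hall : ∀ᶠ k in atTop, ∃ y e : R m, y ∈ mapY (composite f₀ F g) (q k) ∧ ‖e‖ ≤ K ∧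
      (fderiv ℝ F (q k).snd (d k).snd + (d k).fst.snd, e) ∈
        tangentCone (gph (subdiff g)) (F (q k).snd + (q k).fst.snd, y) ∧
      (d k).fst.fst = fderiv ℝ (lagrangianGradient f₀ F) ((q k).snd, y) ((d k).snd, e) := by
    -- The inclusion of `gph M` in `dom Y` is needed on a whole neighborhood of `q k`, not only at
    -- that point, in order to transfer tangents; hence `eventually_nhds`.
    filter_upwards [hq.eventually hU, hd.eventually hN, hq.eventually hev.eventually_nhds,
      hd.norm.eventually_lt_const (lt_add_one _)] with k hkU hkN hkev hkd
    have hdom : q k ∈ dom (mapY (composite f₀ F g)) := hkev.self_of_nhds (hp (φ k)).2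
    have htd : d k ∈ tangentCone (dom (mapY (composite f₀ F g))) (q k) :=
      tangentCone_mono_of_eventually (htan (φ k)) hkev
    obtain ⟨h1, h2⟩ := hUN _ ⟨hkU, hdom⟩ _ hkN
    obtain ⟨κ', hκ', hconst⟩ := exists_fuzzyInnerCalmConst h1 h2 htd
    obtain ⟨y, e, hy, he, ht, hv⟩ :=
      exists_tangent_of_fuzzyInnerCalmConst hf₀ hF hg hlsc hconv hconst
    exact ⟨y, e, hy, he.trans (mul_le_mul hκ' hkd.le (norm_nonneg _) (by positivity)), ht, hv⟩
  obtain ⟨k₀, hk₀⟩ := eventually_atTop.1 hall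
  obtain ⟨y, e, hy, ht, hv⟩ := exists_critical_of_tendsto hf₀ hF hg hlsc hconv hfin' hCQ'
    ((tendsto_add_atTop_iff_nat k₀).2 hq) ((tendsto_add_atTop_iff_nat k₀).2 hd)
    fun k => hk₀ _ (Nat.le_add_left _ _)
  refine hb₀0 ((stronglyNoncritical_iff hf₀ hF).1 (hnc y hy) b₀ e hv.symm ?_)
  rw [hz₀] at ht
  simpa [hq₀] using ht

end Equivalence

end CritMult

theorem mainTheorem5 (n m : ℕ) (f₀ : CritMult.R n → ℝ) (F : CritMult.R n → CritMult.R m)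
    (g : CritMult.R m → EReal)
    (hf₀ : ContDiff ℝ 2 f₀) (hF : ContDiff ℝ 2 F)
    (hg_proper : CritMult.IsProper g) (hg_lsc : LowerSemicontinuous g)
    (hg_convex : CritMult.IsConvex g)
    (xbar : CritMult.R n)
    (hx : (0 : CritMult.R n) ∈
      CritMult.subdiff (fun x => CritMult.composite f₀ F g (CritMult.pair x 0)) xbar) :
    (CritMult.IsolatedlyCalmAround (CritMult.mapM (CritMult.composite f₀ F g))
        (CritMult.pair 0 0) xbar →
      (∀ y ∈ CritMult.mapY (CritMult.composite f₀ F g)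
          (CritMult.pair (CritMult.pair 0 0) xbar),
        CritMult.StronglyNoncritical f₀ F g xbar y) ∧
      ∀ dx : CritMult.R n, dx ≠ 0 →
        CritMult.LocallyUniformlyFuzzyInnerCalm (CritMult.mapY (CritMult.composite f₀ F g))
          (CritMult.pair (CritMult.pair 0 0) xbar)
          (CritMult.pair (CritMult.pair 0 0) dx)) ∧
    (CritMult.BasicCQ F g xbar →
      (∀ y ∈ CritMult.mapY (CritMult.composite f₀ F g)
          (CritMult.pair (CritMult.pair 0 0) xbar),
        CritMult.StronglyNoncritical f₀ F g xbar y) →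
      (∀ dx : CritMult.R n, dx ≠ 0 →
        CritMult.LocallyUniformlyFuzzyInnerCalm (CritMult.mapY (CritMult.composite f₀ F g))
          (CritMult.pair (CritMult.pair 0 0) xbar)
          (CritMult.pair (CritMult.pair 0 0) dx)) →
      CritMult.IsolatedlyCalmAround (CritMult.mapM (CritMult.composite f₀ F g))
        (CritMult.pair 0 0) xbar) := by
  -- Stationarity of `xbar` enters only through this finiteness.
  have hfin : g (F xbar) ≠ ⊤ := by
    simpa using CritMult.coe_add_ne_top.1 hx.1
  exact ⟨fun h => ⟨fun y hy => CritMult.stronglyNoncritical_of_isolatedlyCalmAround hf₀ hF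
      hg_proper hg_lsc hg_convex h hy, fun dx hdx =>
      CritMult.locallyUniformlyFuzzyInnerCalm_of_isolatedlyCalmAround hf₀ hF hg_proper hg_lsc
        hg_convex h hdx⟩,
    fun hCQ hnc hic => CritMult.isolatedlyCalmAround_of_stronglyNoncritical hf₀ hF hg_proper hg_lsc
      hg_convex hfin hCQ hnc hic⟩
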